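/- **Setting.** Let $(E,\|\cdot\|_E)$ be a real Banach space with dual unit ball $B_{E'}$ and let $k\in\mathbb N=\{1,2,\dots\}$. The $k$-fold symmetric algebraic tensor product $\otimes^{k,s}E$ is the linear span in $E\otimes\cdots\otimes E$ of all symmetrizations $\frac1{k!}\sum_{\sigma\in S_k}x_{\sigma(1)}\otimes\cdots\otimes x_{\sigma(k)}$. Each of its elements has the form $U=\sum_{j}\lambda_j\otimes^k x_j$, where $\otimes^k x:=x\otimes\cdots\otimes x$, and its symmetric injective norm is $\|U\|_{\varepsilon_s}:=\sup_{f\in B_{E'}}|\sum_j\lambda_j f(x_j)^k|$. Let $\otimes^{k,s}_{\varepsilon_s}E$ denote the completion. For a probability space $(\Omega,\mathcal A,\mathbb P)$ and $\xi\in L_k(\Omega;E)$ put $\mathbb M^k_\varepsilon[\xi]:=\mathbb E[\otimes^k\xi]\in\otimes^{k,s}_{\varepsilon_s}E$ (Bochner integral). The space $E$ is of Rademacher type $p$ with constant $\tau$ if $\bigl(\mathbb E\|\sum_{j=1}^n r_jx_j\|_E^p\bigr)^{1/p}\le\tau\bigl(\sum_{j=1}^n\|x_j\|_E^p\bigr)^{1/p}$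 for all $n$, all $x_1,\dots,x_n\in E$ and all independent $r_1,\dots,r_n$ with $\mathbb P(r_j=\pm1)=\frac12$. **Theorem ($\alpha\beta\gamma$ theorem).** Let $E$ be of Rademacher type $p\in(1,2]$ with constant $\tau\in(0,\infty)$, let $p'\in[2,\infty)$ satisfy $\frac1p+\frac1{p'}=1$, and let $q\in[p,\infty)$ and $k\in\mathbb N$. Let $X\in L_k(\Omega;E)$, let $(X_\ell)_{\ell\in\mathbb N}\subset L_{kq}(\Omega;E)$, put $X_0:=0$, and define, for $\ell\in\mathbb N$, $$\xi_\ell:=\otimes^kX_\ell-\otimes^kX_{\ell-1}\in L_q(\Omega;\otimes^{k,s}_{\varepsilon_s}E).$$ Let $\mathcal C_\ell$ be the cost of generating one sample of $\xi_\ell$. Suppose that there are positive integers $(N_\ell)_{\ell\in\mathbb N}$ and constants $\alpha,\beta,\gamma,C_\alpha,C_\beta,C_\gamma,C_{\rm stab},c_1,c_2\in(0,\infty)$, $A\in(1,\infty)$ such that, for all $\ell\in\mathbb N$, $c_1A^\ell\le N_\ell\le c_2A^\ell$ and $$\|\mathbb M^k_\varepsilon[X]-\mathbb M^k_\varepsilon[X_\ell]\|_{\varepsilon_s}\le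 C_\alpha N_\ell^{-\alpha},\qquad \|X_\ell-X_{\ell-1}\|_{L_{kq}(\Omega;E)}\le C_\beta N_\ell^{-\beta},$$ $$\mathcal C_\ell\le C_\gamma N_\ell^{\gamma},\qquad \max\{\|X\|_{L_k(\Omega;E)},\|X_\ell\|_{L_{kq}(\Omega;E)}\}\le C_{\rm stab}.$$ For each $\ell\in\mathbb N$ let $(\xi_{\ell,j})_{j\in\mathbb N}\subset L_q(\Omega;\otimes^{k,s}_{\varepsilon_s}E)$ be a sequence of independent copies of $\xi_\ell$ (no independence is required across different levels $\ell$). Then for every $\epsilon\in(0,\frac12]$ there exist $L\in\mathbb N$ and $M_1,\dots,M_L\in\mathbb N$ such that $$\Bigl\|\mathbb M^k_\varepsilon[X]-\sum_{\ell=1}^L\frac1{M_\ell}\sum_{j=1}^{M_\ell}\xi_{\ell,j}\Bigr\|_{L_q(\Omega;\otimes^{k,s}_{\varepsilon_s}E)}<\epsilon$$ and the computational cost of this estimator satisfies $$\sum_{\ell=1}^L M_\ell\,\mathcal C_\ell\;\le\;K\cdot\begin{cases}\epsilon^{-\gamma/\alpha}+\epsilon^{-p'}&\text{if }\beta p'>\gamma,\\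 \epsilon^{-\gamma/\alpha}+\epsilon^{-p'}|\log_A\epsilon|^{p'+1}&\text{if }\beta p'=\gamma,\\ \epsilon^{-\gamma/\alpha}+\epsilon^{-p'-(\gamma-\beta p')/\alpha}&\text{if }\beta p'<\gamma,\end{cases}$$ where the constant $K\in(0,\infty)$ depends only on $\alpha,\beta,\gamma,A,p,q,k,C_\alpha,C_\beta,C_\gamma,C_{\rm stab},c_1,c_2$ and $\tau$. -/

import Mathlib

open MeasureTheory ProbabilityTheory
open scoped TensorProduct ENNReal

universe u v

noncomputable section

section SymmetricInjectiveTensorProduct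

variable (k : ℕ) (E : Type*) [NormedAddCommGroup E] [NormedSpace ℝ E]

/-- The symmetrization `s(x₁ ⊗ ⋯ ⊗ x_k) = (1 / k!) ∑_σ x_{σ(1)} ⊗ ⋯ ⊗ x_{σ(k)}`. -/
def symmetrization {k : ℕ} {E : Type*} [NormedAddCommGroup E] [NormedSpace ℝ E]
    (x : Fin k → E) : ⨂[ℝ] (_ : Fin k), E :=
  ((k.factorial : ℝ)⁻¹) • ∑ σ : Equiv.Perm (Fin k), PiTensorProduct.tprod ℝ (fun i => x (σ i))

/-- The symmetric tensors of order `k`, as a subspace of the algebraic tensor product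
`E ⊗ ⋯ ⊗ E`: the linear span of all symmetrizations. -/
def symmetricTensors : Submodule ℝ (⨂[ℝ] (_ : Fin k), E) :=
  Submodule.span ℝ (Set.range (symmetrization (k := k) (E := E)))

/-- The `k`-fold symmetric algebraic tensor product of `E`. It is a separate type, so that its norm
is the symmetric injective one and not one inherited from the full tensor product. -/
def SymTensor : Type _ := ↥(symmetricTensors k E)

instance SymTensor.instAddCommGroup : AddCommGroup (SymTensor k E) :=
  inferInstanceAs (AddCommGroup ↥(symmetricTensors k E))

instance SymTensor.instModule : Module ℝ (SymTensor k E) :=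
  inferInstanceAs (Module ℝ ↥(symmetricTensors k E))

variable {E}

/-- The pairing of `f ⊗ ⋯ ⊗ f` with algebraic tensors: the linear functional that maps
`x₁ ⊗ ⋯ ⊗ x_k` to `f(x₁) ⋯ f(x_k)`. -/
def evalPow (f : E →L[ℝ] ℝ) : (⨂[ℝ] (_ : Fin k), E) →ₗ[ℝ] ℝ :=
  PiTensorProduct.dualDistrib (PiTensorProduct.tprod ℝ (fun _ => (f : E →ₗ[ℝ] ℝ)))

theorem evalPow_tprod (f : E →L[ℝ] ℝ) (x : Fin k → E) :
    evalPow k f (PiTensorProduct.tprod ℝ x) = ∏ i, f (x i) := by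
  simp [evalPow]

variable (E) in
/-- The inclusion of the symmetric tensors into all tensors. -/
def SymTensor.incl : SymTensor k E →ₗ[ℝ] (⨂[ℝ] (_ : Fin k), E) :=
  (symmetricTensors k E).subtype

/-- The symmetric injective norm
`‖U‖ = sup { |⟨f ⊗ ⋯ ⊗ f, U⟩| : f in the closed unit ball of the dual of E }`;
for `U = ∑ j, λ_j • (x_j ⊗ ⋯ ⊗ x_j)` the quantity inside is `|∑ j, λ_j f(x_j)^k|`. -/
instance SymTensor.instNorm : Norm (SymTensor k E) :=
  ⟨fun U => ⨆ f : {f : E →L[ℝ] ℝ // ‖f‖ ≤ 1}, |evalPow k f.1 (SymTensor.incl k E U)|⟩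

theorem evalPow_bddAbove (U : ⨂[ℝ] (_ : Fin k), E) :
    BddAbove (Set.range fun f : {f : E →L[ℝ] ℝ // ‖f‖ ≤ 1} => |evalPow k f.1 U|) := by
  suffices h : ∃ C : ℝ, ∀ f : E →L[ℝ] ℝ, ‖f‖ ≤ 1 → |evalPow k f U| ≤ C by
    obtain ⟨C, hC⟩ := h
    exact ⟨C, by rintro _ ⟨f, rfl⟩; exact hC f.1 f.2⟩
  induction U using PiTensorProduct.induction_on with
  | smul_tprod r x =>
    refine ⟨|r| * ∏ i, ‖x i‖, fun f hf => ?_⟩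
    rw [map_smul, evalPow_tprod, smul_eq_mul, abs_mul, Finset.abs_prod]
    refine mul_le_mul_of_nonneg_left ?_ (abs_nonneg r)
    refine Finset.prod_le_prod (fun i _ => abs_nonneg _) (fun i _ => ?_)
    calc |f (x i)| ≤ ‖f‖ * ‖x i‖ := f.le_opNorm (x i)
      _ ≤ 1 * ‖x i‖ := mul_le_mul_of_nonneg_right hf (norm_nonneg _)
      _ = ‖x i‖ := one_mul _
  | add U V hU hV =>
    obtain ⟨C, hC⟩ := hU
    obtain ⟨D, hD⟩ := hV
    refine ⟨C + D, fun f hf => ?_⟩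
    rw [map_add]
    exact (abs_add_le _ _).trans (add_le_add (hC f hf) (hD f hf))

theorem SymTensor.normCore : SeminormedSpace.Core ℝ (SymTensor k E) where
  norm_nonneg U := Real.iSup_nonneg fun _ => abs_nonneg _
  norm_smul c U := by
    change (⨆ f : {f : E →L[ℝ] ℝ // ‖f‖ ≤ 1}, |evalPow k f.1 (SymTensor.incl k E (c • U))|)
      = ‖c‖ * ⨆ f : {f : E →L[ℝ] ℝ // ‖f‖ ≤ 1}, |evalPow k f.1 (SymTensor.incl k E U)|
    rw [Real.mul_iSup_of_nonneg (norm_nonneg c)]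
    simp only [map_smul, smul_eq_mul, abs_mul, Real.norm_eq_abs]
  norm_triangle U V := by
    have : Nonempty {f : E →L[ℝ] ℝ // ‖f‖ ≤ 1} := ⟨⟨0, by simp⟩⟩
    refine ciSup_le fun f => ?_
    rw [map_add, map_add]
    exact (abs_add_le _ _).trans (add_le_add
      (le_ciSup (evalPow_bddAbove k (SymTensor.incl k E U)) f)
      (le_ciSup (evalPow_bddAbove k (SymTensor.incl k E V)) f))

instance SymTensor.instSeminormedAddCommGroup : SeminormedAddCommGroup (SymTensor k E) :=
  SeminormedAddCommGroup.ofCore (SymTensor.normCore (E := E) k)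

instance SymTensor.instNormedSpace : NormedSpace ℝ (SymTensor k E) where
  norm_smul_le c U := ((SymTensor.normCore k).norm_smul c U).le

variable (E) in
/-- The `k`-fold symmetric injective tensor product of `E`: the completion of the symmetric
algebraic tensor product with respect to the symmetric injective norm. -/
abbrev SymInjTensor : Type _ := UniformSpace.Completion (SymTensor k E)

instance SymInjTensor.instMeasurableSpace : MeasurableSpace (SymInjTensor k E) := borel _

instance SymInjTensor.instBorelSpace : BorelSpace (SymInjTensor k E) := ⟨rfl⟩

theorem tprod_const_mem (x : E) :
    PiTensorProduct.tprod ℝ (fun _ : Fin k => x) ∈ symmetricTensors k E := by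
  refine Submodule.subset_span ⟨fun _ => x, ?_⟩
  have hk : ((k.factorial : ℝ)) ≠ 0 := by exact_mod_cast k.factorial_ne_zero
  simp only [symmetrization, Finset.sum_const, Finset.card_univ, Fintype.card_perm,
    Fintype.card_fin]
  rw [← Nat.cast_smul_eq_nsmul ℝ, smul_smul, inv_mul_cancel₀ hk, one_smul]

/-- The elementary tensor `x ⊗ ⋯ ⊗ x` (`k` factors) as a symmetric algebraic tensor. -/
def symPow (x : E) : SymTensor k E :=
  ⟨PiTensorProduct.tprod ℝ (fun _ : Fin k => x), tprod_const_mem k x⟩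

/-- The elementary tensor `x ⊗ ⋯ ⊗ x` (`k` factors) in the symmetric injective tensor product. -/
def tensorPow (x : E) : SymInjTensor k E := ((symPow k x : SymTensor k E) : SymInjTensor k E)

end SymmetricInjectiveTensorProduct

section Rademacher

/-- A Rademacher family: independent random variables with values in `{-1, 1}`, each value being
taken with probability `1 / 2`. -/
structure IsRademacherFamily {J S : Type*} [MeasurableSpace S] (P : Measure S)
    (r : J → S → ℝ) : Prop where
  measurable : ∀ j, Measurable (r j)
  values : ∀ j ω, r j ω = -1 ∨ r j ω = 1
  prob_neg_one : ∀ j, P {ω | r j ω = -1} = 1 / 2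
  prob_one : ∀ j, P {ω | r j ω = 1} = 1 / 2
  indep : iIndepFun r P

/-- `F` has Rademacher type `p` with constant `τ`. -/
def HasRademacherTypeWith (p τ : ℝ) (F : Type*) [NormedAddCommGroup F] [NormedSpace ℝ F] : Prop :=
  ∀ (S : Type) [MeasurableSpace S] (P : Measure S) [IsProbabilityMeasure P] [P.IsComplete]
    (n : ℕ) (r : Fin n → S → ℝ), IsRademacherFamily P r → ∀ x : Fin n → F,
    (∫ ω, ‖∑ j, r j ω • x j‖ ^ p ∂P) ^ (1 / p) ≤ τ * (∑ j, ‖x j‖ ^ p) ^ (1 / p)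

end Rademacher

section MultilevelMonteCarlo

variable {E : Type*} [NormedAddCommGroup E] [NormedSpace ℝ E]
  {Ω : Type*} [MeasurableSpace Ω]

/-- The injective `k`-th moment `𝕄ᵏ[X] = 𝔼[X ⊗ ⋯ ⊗ X]`, a Bochner integral (which exists for
`X ∈ L_k(Ω; E)`). -/
def injMoment (k : ℕ) (X : Ω → E) (μ : Measure Ω) : SymInjTensor k E :=
  ∫ ω, tensorPow k (X ω) ∂μ

/-- The level difference `ξ_ℓ = ⊗ᵏ X_ℓ - ⊗ᵏ X_{ℓ-1}`, used for `ℓ ≥ 1`. -/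
def levelDiff (k : ℕ) (X : ℕ → Ω → E) (l : ℕ) (ω : Ω) : SymInjTensor k E :=
  tensorPow k (X l ω) - tensorPow k (X (l - 1) ω)

/-- The multilevel Monte Carlo estimator `∑_{ℓ=1}^L (1 / M_ℓ) ∑_{j<M_ℓ} ξ_{ℓ,j}`. -/
def mlmcEstimator {k : ℕ} (ξ : ℕ → ℕ → Ω → SymInjTensor k E) (L : ℕ) (M : ℕ → ℕ) (ω : Ω) :
    SymInjTensor k E :=
  ∑ l ∈ Finset.Icc 1 L, ((M l : ℝ)⁻¹) • ∑ j ∈ Finset.range (M l), ξ l j ω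

/-- The cost of the multilevel Monte Carlo estimator: `M_ℓ` samples at cost `cost ℓ` each on every
level `ℓ = 1, …, L`. -/
def mlmcCost (cost : ℕ → ℝ) (L : ℕ) (M : ℕ → ℕ) : ℝ :=
  ∑ l ∈ Finset.Icc 1 L, (M l : ℝ) * cost l

/-- The order of the computational cost in terms of the accuracy `ε`, by the three cases
`β p' > γ`, `β p' = γ`, `β p' < γ`. -/
def costRate (α β γ A p' ε : ℝ) : ℝ :=
  if γ < β * p' then ε ^ (-(γ / α)) + ε ^ (-p')
  else if β * p' = γ then ε ^ (-(γ / α)) + ε ^ (-p') * |Real.logb A ε| ^ (p' + 1)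
  else ε ^ (-(γ / α)) + ε ^ (-p' - (γ - β * p') / α)

end MultilevelMonteCarlo

end

/-!
The injective tensor product need not have type `p`, but the differences `⊗ᵏx - ⊗ᵏy` behave as if it
had. The norm of a Rademacher sum of such differences is a supremum, over `f` in the dual unit ball,
of sums of `±(f(x)ᵏ - f(y)ᵏ)`. The increments of these functions of `f` are dominated by those of
two linear functions, given by multiples of `x` and of `x - y` whose norms are of order
`max(‖x‖, ‖y‖)ᵏ⁻¹ ‖x - y‖`. A contraction principle therefore compares the sum with a Rademacher sum
in `E`, to which type `p` of `E` applies. Sub-Gaussian concentration passes from first to `q`-th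
moments, symmetrization from Rademacher sums to the Monte Carlo error, and Hölder's inequality
bounds the result by `‖X - Y‖` in `L_{kq}`: with `M` samples the error on level `ℓ` is at most a
constant times `M ^ (-1 / p') * A ^ (-β ℓ)`.

Minimizing the cost for a total statistical error of order `ε` by Lagrange multipliers gives, up to
rounding, a cost of order `ε ^ (-p') * (∑ ℓ ≤ L, A ^ ((γ - β p') ℓ / (p' + 1))) ^ (p' + 1)`, where
`A ^ (α L)` is of order `ε⁻¹`. The three cases are those of a convergent, a constant and a divergent
geometric sum.
-/

section SignAverage

/-- The average of `Φ (v ± x₁ ± ⋯ ± xₙ)` over all choices of the signs, that is, the expectation of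
`Φ` along a Rademacher sum started at `v`; the recursion flips one coin at a time. -/
noncomputable def signAverage {V : Type*} [AddCommGroup V] (Φ : V → ℝ) : List V → V → ℝ
  | [], v => Φ v
  | x :: L, v => (signAverage Φ L (v + x) + signAverage Φ L (v - x)) / 2

section AddCommGroup

variable {V : Type*} [AddCommGroup V]

@[simp]
theorem signAverage_nil (Φ : V → ℝ) (v : V) : signAverage Φ [] v = Φ v := rfl

theorem signAverage_cons (Φ : V → ℝ) (x : V) (L : List V) (v : V) :
    signAverage Φ (x :: L) v = (signAverage Φ L (v + x) + signAverage Φ L (v - x)) / 2 := rfl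

theorem signAverage_mono_of_mem {S : AddSubgroup V} {Φ Ψ : V → ℝ} (h : ∀ v ∈ S, Φ v ≤ Ψ v)
    {L : List V} (hL : ∀ x ∈ L, x ∈ S) {v : V} (hv : v ∈ S) :
    signAverage Φ L v ≤ signAverage Ψ L v := by
  induction L generalizing v with
  | nil => exact h v hv
  | cons x L ih =>
    obtain ⟨hx, hL⟩ := List.forall_mem_cons.1 hL
    simp only [signAverage_cons]
    linarith [ih hL (S.add_mem hv hx), ih hL (S.sub_mem hv hx)]

theorem signAverage_mono {Φ Ψ : V → ℝ} (h : ∀ v, Φ v ≤ Ψ v) (L : List V) (v : V) :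
    signAverage Φ L v ≤ signAverage Ψ L v :=
  signAverage_mono_of_mem (S := ⊤) (fun v _ => h v) (fun _ _ => trivial) trivial

theorem signAverage_add (Φ Ψ : V → ℝ) (L : List V) (v : V) :
    signAverage (fun w => Φ w + Ψ w) L v = signAverage Φ L v + signAverage Ψ L v := by
  induction L generalizing v with
  | nil => rfl
  | cons x L ih => simp only [signAverage_cons, ih]; ring

theorem signAverage_const_mul (c : ℝ) (Φ : V → ℝ) (L : List V) (v : V) :
    signAverage (fun w => c * Φ w) L v = c * signAverage Φ L v := by
  induction L generalizing v with
  | nil => rfl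
  | cons x L ih => simp only [signAverage_cons, ih]; ring

theorem signAverage_comp_neg (Φ : V → ℝ) (L : List V) (v : V) :
    signAverage (fun w => Φ (-w)) L v = signAverage Φ L (-v) := by
  induction L generalizing v with
  | nil => rfl
  | cons x L ih =>
    simp only [signAverage_cons, ih, neg_add', neg_sub', sub_neg_eq_add]
    ring

theorem signAverage_map {W : Type*} [AddCommGroup W] (T : W →+ V) (Φ : V → ℝ) (L : List W) (w : W) :
    signAverage Φ (L.map T) (T w) = signAverage (fun w => Φ (T w)) L w := by
  induction L generalizing w with
  | nil => rfl
  | cons x L ih => simp only [List.map_cons, signAverage_cons, ← map_add, ← map_sub, ih]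

theorem signAverage_signAverage_singleton (Φ : V → ℝ) (x : V) (L : List V) (v : V) :
    signAverage (signAverage Φ [x]) L v = signAverage Φ (x :: L) v := by
  induction L generalizing v with
  | nil => rfl
  | cons y L ih =>
    simp only [signAverage_cons] at ih ⊢
    rw [ih, ih, add_right_comm v y x, add_sub_right_comm v y x, ← add_sub_right_comm v x y,
      sub_right_comm v y x]
    ring

theorem signAverage_signAverage_pair (Φ : V → ℝ) (x y : V) (L : List V) (v : V) :
    signAverage (signAverage Φ [x, y]) L v = signAverage Φ (x :: y :: L) v := by
  have h : signAverage Φ [x, y] = signAverage (signAverage Φ [y]) [x] := rfl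
  simp only [h, signAverage_signAverage_singleton, signAverage_cons]

theorem signAverage_mem_of_convexOn {s : Set ℝ} {g : ℝ → ℝ} (hg : ConvexOn ℝ s g) {Φ : V → ℝ}
    (hΦ : ∀ v, Φ v ∈ s) (L : List V) (v : V) :
    signAverage Φ L v ∈ s ∧ g (signAverage Φ L v) ≤ signAverage (fun w => g (Φ w)) L v := by
  have half : (2⁻¹ : ℝ) + 2⁻¹ = 1 := by norm_num
  induction L generalizing v with
  | nil => exact ⟨hΦ v, le_rfl⟩
  | cons x L ih =>
    obtain ⟨mem_add, le_add⟩ := ih (v + x)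
    obtain ⟨mem_sub, le_sub⟩ := ih (v - x)
    have midpoint_mem := hg.1 mem_add mem_sub (by norm_num) (by norm_num) half
    have jensen := hg.2 mem_add mem_sub (by norm_num) (by norm_num) half
    simp only [smul_eq_mul, ← div_eq_inv_mul, ← add_div] at midpoint_mem jensen
    simp only [signAverage_cons]
    exact ⟨midpoint_mem, jensen.trans (by gcongr)⟩

/-- The sign `1` or `-1` encoded by a Boolean. -/
def boolSign (b : Bool) : ℝ := if b then 1 else -1

theorem boolSign_injective : Function.Injective boolSign := by
  intro b c
  cases b <;> cases c <;> norm_num [boolSign]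

theorem signAverage_ofFn [Module ℝ V] (Φ : V → ℝ) {n : ℕ} (x : Fin n → V) (v : V) :
    signAverage Φ (List.ofFn x) v
      = (2 ^ n : ℝ)⁻¹ * ∑ s : Fin n → Bool, Φ (v + ∑ j, boolSign (s j) • x j) := by
  induction n generalizing v with
  | zero => simp
  | succ n ih =>
    rw [List.ofFn_succ, signAverage_cons, ih, ih, ← (Fin.consEquiv fun _ => Bool).sum_comp,
      Fintype.sum_prod_type]
    simp only [Fin.consEquiv_apply, Fin.sum_univ_succ, Fin.cons_zero, Fin.cons_succ,
      Fintype.sum_bool, boolSign, if_true, one_smul, neg_smul, Bool.false_eq_true, if_false,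
      ← add_assoc, ← sub_eq_add_neg, pow_succ, mul_inv]
    ring

end AddCommGroup

section Contraction

open BoundedContinuousFunction

variable {I : Type*} [TopologicalSpace I] {ι : Type*}

theorem signAverage_iSup_singleton_le [Nonempty I] {φ a b : I →ᵇ ℝ}
    (h : ∀ i j, |φ i - φ j| ≤ max |a i - a j| |b i - b j|) (w : I →ᵇ ℝ) :
    signAverage (fun u : I →ᵇ ℝ => ⨆ i, u i) [φ] w
      ≤ signAverage (fun u : I →ᵇ ℝ => ⨆ i, u i) [a, b] w := by
  simp only [signAverage_cons, signAverage_nil]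
  set sup : (I →ᵇ ℝ) → ℝ := fun u => ⨆ i, u i
  have le_sup (u : I →ᵇ ℝ) (i : I) : u i ≤ sup u :=
    le_ciSup u.isBounded_range.bddAbove i
  have add_le (i j : I) : (w + φ) i + (w - φ) j ≤
      (sup (w + a + b) + sup (w + a - b) + (sup (w - a + b) + sup (w - a - b))) / 2 := by
    have hpp := le_sup (w + a + b)
    have hpm := le_sup (w + a - b)
    have hmp := le_sup (w - a + b)
    have hmm := le_sup (w - a - b)
    simp only [coe_add, coe_sub, Pi.add_apply, Pi.sub_apply] at hpp hpm hmp hmm ⊢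
    -- The family attaining the maximum absorbs the increment of `φ`; the other is averaged out.
    rcases le_max_iff.1 ((le_abs_self _).trans (h i j)) with hij | hij <;>
      rcases abs_cases (a i - a j) with ⟨ha, -⟩ | ⟨ha, -⟩ <;>
      rcases abs_cases (b i - b j) with ⟨hb, -⟩ | ⟨hb, -⟩ <;>
      linarith [hpp i, hpp j, hpm i, hpm j, hmp i, hmp j, hmm i, hmm j]
  have sup_le (j : I) : sup (w + φ) ≤ _ - (w - φ) j :=
    ciSup_le fun i => le_sub_iff_add_le.2 (add_le i j)
  have sup_sub_le : sup (w - φ) ≤ _ - sup (w + φ) :=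
    ciSup_le fun j => le_sub_comm.1 (sup_le j)
  linarith

theorem signAverage_iSup_map_le [Nonempty I] {φ a b : ι → I →ᵇ ℝ}
    (h : ∀ j i i', |φ j i - φ j i'| ≤ max |a j i - a j i'| |b j i - b j i'|)
    (L : List ι) (w : I →ᵇ ℝ) :
    signAverage (fun u : I →ᵇ ℝ => ⨆ i, u i) (L.map φ) w
      ≤ signAverage (fun u : I →ᵇ ℝ => ⨆ i, u i) (L.flatMap fun j => [a j, b j]) w := by
  induction L generalizing w with
  | nil => exact le_rfl
  | cons j L ih =>
    set sup : (I →ᵇ ℝ) → ℝ := fun u => ⨆ i, u i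
    set M := L.flatMap fun j => [a j, b j]
    calc signAverage sup (φ j :: L.map φ) w
        = signAverage (signAverage sup [φ j]) (L.map φ) w :=
          (signAverage_signAverage_singleton ..).symm
      _ ≤ signAverage (signAverage sup [a j, b j]) (L.map φ) w :=
          signAverage_mono (signAverage_iSup_singleton_le (h j)) _ w
      _ = signAverage sup (a j :: b j :: L.map φ) w := signAverage_signAverage_pair ..
      _ ≤ signAverage sup (a j :: b j :: M) w := by
          simp only [signAverage_cons]
          linarith [ih (w + a j + b j), ih (w + a j - b j), ih (w - a j + b j),
            ih (w - a j - b j)]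

theorem norm_le_iSup_add_iSup_neg {f : I →ᵇ ℝ} {i₀ : I} (h : f i₀ = 0) :
    ‖f‖ ≤ (⨆ i, f i) + ⨆ i, (-f) i := by
  have le_sup (i : I) : f i ≤ ⨆ i, f i := le_ciSup f.isBounded_range.bddAbove i
  have neg_le_sup (i : I) : -f i ≤ ⨆ i, (-f) i := le_ciSup (-f).isBounded_range.bddAbove i
  have sup_nonneg := le_sup i₀
  have sup_neg_nonneg := neg_le_sup i₀
  rw [h] at sup_nonneg sup_neg_nonneg
  refine (norm_le (by linarith)).2 fun i => abs_le.2 ⟨?_, ?_⟩ <;>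
    linarith [le_sup i, neg_le_sup i]

theorem signAverage_norm_map_le {φ a b : ι → I →ᵇ ℝ} {i₀ : I} (h₀ : ∀ j, φ j i₀ = 0)
    (h : ∀ j i i', |φ j i - φ j i'| ≤ max |a j i - a j i'| |b j i - b j i'|) (L : List ι) :
    signAverage (fun u : I →ᵇ ℝ => ‖u‖) (L.map φ) 0
      ≤ 2 * signAverage (fun u : I →ᵇ ℝ => ‖u‖) (L.flatMap fun j => [a j, b j]) 0 := by
  have : Nonempty I := ⟨i₀⟩
  set sup : (I →ᵇ ℝ) → ℝ := fun u => ⨆ i, u i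
  set M := L.flatMap fun j => [a j, b j]
  let S : AddSubgroup (I →ᵇ ℝ) := (evalCLM ℝ i₀ : (I →ᵇ ℝ) →L[ℝ] ℝ).toLinearMap.ker.toAddSubgroup
  have φ_mem : ∀ u ∈ L.map φ, u ∈ S := List.forall_mem_map.2 fun j _ => h₀ j
  calc signAverage (fun u => ‖u‖) (L.map φ) 0
      ≤ signAverage (fun u => sup u + sup (-u)) (L.map φ) 0 :=
        signAverage_mono_of_mem (fun u hu => norm_le_iSup_add_iSup_neg hu) φ_mem S.zero_mem
    _ = 2 * signAverage sup (L.map φ) 0 := by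
        rw [signAverage_add, signAverage_comp_neg, neg_zero, two_mul]
    _ ≤ 2 * signAverage (fun u => ‖u‖) M 0 := by
        gcongr
        refine (signAverage_iSup_map_le h L 0).trans (signAverage_mono (fun u => ?_) M 0)
        exact ciSup_le fun i => (le_abs_self _).trans (u.norm_coe_le_norm i)

end Contraction

section Moments

variable {V : Type*} [SeminormedAddCommGroup V]

theorem signAverage_norm_nonneg (L : List V) (v : V) : 0 ≤ signAverage (fun v => ‖v‖) L v :=
  (signAverage_mem_of_convexOn (convexOn_id (convex_Ici 0)) norm_nonneg L v).1

theorem abs_signAverage_norm_sub_le (L : List V) (v w : V) :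
    |signAverage (fun v => ‖v‖) L v - signAverage (fun v => ‖v‖) L w| ≤ ‖v - w‖ := by
  induction L generalizing v w with
  | nil => exact abs_norm_sub_norm_le v w
  | cons x L ih =>
    have add_le := ih (v + x) (w + x)
    have sub_le := ih (v - x) (w - x)
    rw [add_sub_add_right_eq_sub] at add_le
    rw [sub_sub_sub_cancel_right] at sub_le
    simp only [signAverage_cons]
    rw [abs_le] at *
    constructor <;> linarith [add_le.1, add_le.2, sub_le.1, sub_le.2]

theorem exp_add_exp_div_two_le (a b : ℝ) :
    (Real.exp a + Real.exp b) / 2 ≤ Real.exp ((a + b) / 2 + ((a - b) / 2) ^ 2 / 2) := by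
  calc (Real.exp a + Real.exp b) / 2 = Real.exp ((a + b) / 2) * Real.cosh ((a - b) / 2) := by
        rw [Real.cosh_eq, ← mul_div_assoc, mul_add, ← Real.exp_add, ← Real.exp_add]
        ring_nf
    _ ≤ Real.exp ((a + b) / 2) * Real.exp (((a - b) / 2) ^ 2 / 2) := by
        gcongr
        exact Real.cosh_le_exp_half_sq _
    _ = _ := (Real.exp_add _ _).symm

/-- Sub-Gaussian concentration: each sign moves the conditional mean of the norm by at most `‖x‖`,
so the martingale of conditional means obeys Azuma's exponential bound. -/
theorem signAverage_exp_mul_norm_le (c : ℝ) (L : List V) (v : V) :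
    signAverage (fun v => Real.exp (c * ‖v‖)) L v
      ≤ Real.exp (c * signAverage (fun v => ‖v‖) L v
        + c ^ 2 * (L.map fun x => ‖x‖ ^ 2).sum / 2) := by
  induction L generalizing v with
  | nil => simp
  | cons x L ih =>
    have ih_add := ih (v + x)
    have ih_sub := ih (v - x)
    simp only [signAverage_cons, List.map_cons, List.sum_cons]
    set s := (L.map fun x => ‖x‖ ^ 2).sum
    set a := signAverage (fun v => ‖v‖) L (v + x)
    set b := signAverage (fun v => ‖v‖) L (v - x)
    have dist_le : |(a - b) / 2| ≤ ‖x‖ := by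
      have := (abs_signAverage_norm_sub_le L (v + x) (v - x)).trans_eq
        (congrArg norm (add_sub_sub_cancel v x x))
      rw [abs_div, abs_two, div_le_iff₀ two_pos, mul_two]
      exact this.trans (norm_add_le x x)
    have sq_le : (c * ((a - b) / 2)) ^ 2 ≤ c ^ 2 * ‖x‖ ^ 2 := by
      rw [mul_pow, ← sq_abs ((a - b) / 2)]
      gcongr
    calc _ ≤ (Real.exp (c * a + c ^ 2 * s / 2) + Real.exp (c * b + c ^ 2 * s / 2)) / 2 := by
          linarith
      _ ≤ _ := exp_add_exp_div_two_le _ _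
      _ ≤ _ := by
          refine Real.exp_le_exp.2 ?_
          ring_nf at sq_le ⊢
          linarith

/-- The constant with which the `q`-th moment of the norm of a Rademacher sum is bounded by its
first moment and the square sum of the summands. -/
noncomputable def kahaneConst (q : ℝ) : ℝ := q * Real.exp (3 / (2 * q))

theorem kahaneConst_pos {q : ℝ} (hq : 0 < q) : 0 < kahaneConst q :=
  mul_pos hq (Real.exp_pos _)

theorem kahaneConst_mul_rpow {q B : ℝ} (hq : 0 < q) (hB : 0 ≤ B) :
    (kahaneConst q * B) ^ q = (q * B) ^ q * Real.exp (3 / 2) := by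
  rw [kahaneConst, mul_right_comm, Real.mul_rpow (by positivity) (Real.exp_nonneg _),
    ← Real.exp_mul]
  congr 2
  field_simp

theorem rpow_le_mul_exp_inv_mul {q B t : ℝ} (hq : 0 < q) (hB : 0 < B) (ht : 0 ≤ t) :
    t ^ q ≤ (q * B) ^ q * Real.exp (B⁻¹ * t) := by
  have le_exp : t / (q * B) ≤ Real.exp (t / (q * B)) :=
    (le_add_of_nonneg_right zero_le_one).trans (Real.add_one_le_exp _)
  calc t ^ q = (q * B) ^ q * (t / (q * B)) ^ q := by
        rw [← Real.mul_rpow (by positivity) (by positivity), mul_div_cancel₀ _ (by positivity)]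
    _ ≤ (q * B) ^ q * Real.exp (t / (q * B)) ^ q := by gcongr
    _ = (q * B) ^ q * Real.exp (B⁻¹ * t) := by
        rw [← Real.exp_mul]
        congr 2
        field_simp

theorem signAverage_norm_rpow_le_of_pos {q B : ℝ} (hq : 0 < q) (hB : 0 < B) {L : List V}
    (h_mean : signAverage (fun v => ‖v‖) L 0 ≤ B) (h_sq : (L.map fun x => ‖x‖ ^ 2).sum ≤ B ^ 2) :
    signAverage (fun v => ‖v‖ ^ q) L 0 ≤ (kahaneConst q * B) ^ q := by
  calc signAverage (fun v => ‖v‖ ^ q) L 0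
      ≤ signAverage (fun v => (q * B) ^ q * Real.exp (B⁻¹ * ‖v‖)) L 0 :=
        signAverage_mono (fun v => rpow_le_mul_exp_inv_mul hq hB (norm_nonneg v)) L 0
    _ ≤ (q * B) ^ q * Real.exp (B⁻¹ * signAverage (fun v => ‖v‖) L 0
          + B⁻¹ ^ 2 * (L.map fun x => ‖x‖ ^ 2).sum / 2) := by
        rw [signAverage_const_mul]
        gcongr
        exact signAverage_exp_mul_norm_le _ L 0
    _ ≤ (q * B) ^ q * Real.exp (B⁻¹ * B + B⁻¹ ^ 2 * B ^ 2 / 2) := by gcongr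
    _ = (kahaneConst q * B) ^ q := by
        rw [kahaneConst_mul_rpow hq hB.le]
        congr 2
        field_simp
        norm_num

theorem signAverage_norm_rpow_le {q B : ℝ} (hq : 0 < q) (hB : 0 ≤ B) {L : List V}
    (h_mean : signAverage (fun v => ‖v‖) L 0 ≤ B) (h_sq : (L.map fun x => ‖x‖ ^ 2).sum ≤ B ^ 2) :
    signAverage (fun v => ‖v‖ ^ q) L 0 ≤ (kahaneConst q * B) ^ q := by
  have bound : ∀ C ∈ Set.Ioi B, signAverage (fun v => ‖v‖ ^ q) L 0 ≤ (kahaneConst q * C) ^ q :=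
    fun C hC => signAverage_norm_rpow_le_of_pos hq (hB.trans_lt hC) (h_mean.trans hC.le)
      (h_sq.trans (pow_le_pow_left₀ hB hC.le 2))
  have cont : Continuous fun C : ℝ => (kahaneConst q * C) ^ q :=
    (continuous_const.mul continuous_id).rpow_const fun _ => .inr hq.le
  exact ge_of_tendsto (cont.continuousWithinAt (s := Set.Ioi B))
    (Filter.eventually_of_mem self_mem_nhdsWithin bound)

end Moments

section RademacherType

theorem pi_uniformOfFintype_boolSign_eq {n : ℕ} (j : Fin n) (b : Bool) :
    (Measure.pi fun _ : Fin n => (PMF.uniformOfFintype Bool).toMeasure)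
      {s | boolSign (s j) = boolSign b} = 1 / 2 := by
  have preimage_eq : {s : Fin n → Bool | boolSign (s j) = boolSign b}
      = Function.eval j ⁻¹' ({b} : Set Bool) :=
    Set.ext fun s => boolSign_injective.eq_iff
  rw [preimage_eq, (measurePreserving_eval _ j).measure_preimage
    (Set.toFinite _).measurableSet.nullMeasurableSet, PMF.toMeasure_apply_singleton _ _
    (Set.toFinite _).measurableSet]
  simp

theorem isRademacherFamily_boolSign (n : ℕ) :
    IsRademacherFamily (Measure.pi fun _ : Fin n => (PMF.uniformOfFintype Bool).toMeasure)
      (fun j s => boolSign (s j)) where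
  measurable j := (measurable_of_finite boolSign).comp (measurable_pi_apply j)
  values j s := by cases h : s j <;> simp [boolSign]
  prob_neg_one j := pi_uniformOfFintype_boolSign_eq j false
  prob_one j := pi_uniformOfFintype_boolSign_eq j true
  indep := iIndepFun_pi (X := fun _ => boolSign) fun _ =>
    (measurable_of_finite boolSign).aemeasurable

theorem integral_boolSign_eq_signAverage {F : Type*} [AddCommGroup F] [Module ℝ F] (Φ : F → ℝ)
    {n : ℕ} (x : Fin n → F) :
    ∫ s, Φ (∑ j, boolSign (s j) • x j)
        ∂(Measure.pi fun _ : Fin n => (PMF.uniformOfFintype Bool).toMeasure)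
      = signAverage Φ (List.ofFn x) 0 := by
  rw [signAverage_ofFn, integral_fintype Integrable.of_finite, Finset.mul_sum]
  refine Finset.sum_congr rfl fun s _ => ?_
  simp [Measure.real, Measure.pi_singleton, ENNReal.toReal_pow]

theorem HasRademacherTypeWith.signAverage_norm_le {p τ : ℝ} (hp : 1 ≤ p) {F : Type*}
    [NormedAddCommGroup F] [NormedSpace ℝ F] (hF : HasRademacherTypeWith p τ F) (L : List F) :
    signAverage (fun v => ‖v‖) L 0 ≤ τ * (L.map fun x => ‖x‖ ^ p).sum ^ (1 / p) := by
  obtain ⟨n, x, rfl⟩ : ∃ (n : ℕ) (x : Fin n → F), L = List.ofFn x :=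
    ⟨_, L.get, (List.ofFn_get L).symm⟩
  let P := Measure.pi fun _ : Fin n => (PMF.uniformOfFintype Bool).toMeasure
  have : P.IsComplete := ⟨fun s _ => s.toFinite.measurableSet⟩
  obtain ⟨mean_nonneg, jensen⟩ :=
    signAverage_mem_of_convexOn (convexOn_rpow hp) (norm_nonneg (E := F)) (List.ofFn x) 0
  calc signAverage (fun v => ‖v‖) (List.ofFn x) 0
      = (signAverage (fun v => ‖v‖) (List.ofFn x) 0 ^ p) ^ (1 / p) := by
        rw [one_div, Real.rpow_rpow_inv mean_nonneg (by positivity)]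
    _ ≤ (signAverage (fun v => ‖v‖ ^ p) (List.ofFn x) 0) ^ (1 / p) := by
        have := Real.rpow_nonneg mean_nonneg p
        gcongr
    _ = (∫ s, ‖∑ j, boolSign (s j) • x j‖ ^ p ∂P) ^ (1 / p) := by
        rw [← integral_boolSign_eq_signAverage]
    _ ≤ τ * (∑ j, ‖x j‖ ^ p) ^ (1 / p) := hF _ P n _ (isRademacherFamily_boolSign n) x
    _ = τ * ((List.ofFn x).map fun x => ‖x‖ ^ p).sum ^ (1 / p) := by
        rw [List.map_ofFn, List.sum_ofFn]
        rfl

end RademacherType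

end SignAverage

section RademacherDomination

variable {S S' T : Type*}

theorem sum_map_rpow_nonneg {a : S → ℝ} (ha : ∀ s, 0 ≤ a s) (p : ℝ) (L : List S) :
    0 ≤ (L.map fun s => a s ^ p).sum :=
  List.sum_nonneg (List.forall_mem_map.2 fun s _ => Real.rpow_nonneg (ha s) p)

theorem sum_map_rpow_le_rpow_sum_map {a : S → ℝ} (ha : ∀ s, 0 ≤ a s) {p r : ℝ} (hp : 0 < p)
    (hr : p ≤ r) (L : List S) :
    (L.map fun s => a s ^ r).sum ≤ (L.map fun s => a s ^ p).sum ^ (r / p) := by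
  induction L with
  | nil => simpa using Real.rpow_nonneg le_rfl _
  | cons s L ih =>
    simp only [List.map_cons, List.sum_cons]
    have superadditive := Real.add_rpow_le_rpow_add (Real.rpow_nonneg (ha s) p)
      (sum_map_rpow_nonneg ha p L) ((one_le_div hp).2 hr)
    rw [← Real.rpow_mul (ha s), mul_div_cancel₀ _ hp.ne'] at superadditive
    linarith

/-- The Rademacher averages of the map `D` are dominated, with constant `C`, by the `ℓ_p` norms of
the weights `a`. This is the type `p` inequality for the values of a possibly nonlinear map `D`
into a space that need not have type `p` itself. -/
def IsRademacherDominated [SeminormedAddCommGroup T] (p C : ℝ) (D : S → T) (a : S → ℝ) : Prop :=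
  ∀ L : List S,
    signAverage (fun v => ‖v‖) (L.map D) 0 ≤ C * (L.map fun s => a s ^ p).sum ^ (1 / p)

namespace IsRademacherDominated

theorem comp [SeminormedAddCommGroup T] {p C : ℝ} {D : S → T} {a : S → ℝ}
    (h : IsRademacherDominated p C D a) (g : S' → S) :
    IsRademacherDominated p C (fun s => D (g s)) (fun s => a (g s)) := by
  intro L
  simpa only [List.map_map, Function.comp_def] using h (L.map g)

theorem norm_le [SeminormedAddCommGroup T] {p C : ℝ} {D : S → T} {a : S → ℝ}
    (h : IsRademacherDominated p C D a) (hp : p ≠ 0) (ha : ∀ s, 0 ≤ a s) (s : S) :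
    ‖D s‖ ≤ C * a s := by
  have singleton := h [s]
  simp only [List.map_cons, List.map_nil, signAverage_cons, signAverage_nil, zero_add, zero_sub,
    norm_neg, List.sum_cons, List.sum_nil, add_zero, one_div,
    Real.rpow_rpow_inv (ha s) hp] at singleton
  linarith

theorem signAverage_rpow_le [SeminormedAddCommGroup T] {p C : ℝ} {D : S → T} {a : S → ℝ}
    (h : IsRademacherDominated p C D a) (hp : 0 < p) (hp2 : p ≤ 2) (ha : ∀ s, 0 ≤ a s) {q : ℝ}
    (hq : 0 < q) (L : List S) :
    signAverage (fun v => ‖v‖ ^ q) (L.map D) 0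
      ≤ (kahaneConst q * (C * (L.map fun s => a s ^ p).sum ^ (1 / p))) ^ q := by
  refine signAverage_norm_rpow_le hq ((signAverage_norm_nonneg _ _).trans (h L)) (h L) ?_
  have sum_nonneg := sum_map_rpow_nonneg ha p L
  calc ((L.map D).map fun v => ‖v‖ ^ 2).sum
      ≤ (L.map fun s => C ^ 2 * a s ^ (2 : ℝ)).sum := by
        rw [List.map_map]
        refine List.sum_le_sum fun s _ => ?_
        rw [Function.comp_apply, Real.rpow_two, ← mul_pow]
        exact pow_le_pow_left₀ (norm_nonneg _) (h.norm_le hp.ne' ha s) 2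
    _ = C ^ 2 * (L.map fun s => a s ^ (2 : ℝ)).sum := List.sum_map_mul_left _ _ _
    _ ≤ C ^ 2 * (L.map fun s => a s ^ p).sum ^ (2 / p) := by
        gcongr
        exact sum_map_rpow_le_rpow_sum_map ha hp hp2 L
    _ = (C * (L.map fun s => a s ^ p).sum ^ (1 / p)) ^ 2 := by
        rw [mul_pow, ← Real.rpow_mul_natCast sum_nonneg, Nat.cast_ofNat, one_div_mul_eq_div]

variable [NormedAddCommGroup T] [NormedSpace ℝ T] {p q C : ℝ} {D : S → T} {a : S → ℝ}

theorem sum_norm_rpow_le (h : IsRademacherDominated p C D a) (hp : 0 < p) (hp2 : p ≤ 2)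
    (hq : p ≤ q) (hC : 0 ≤ C) (ha : ∀ s, 0 ≤ a s) {n : ℕ} (x : Fin n → S) :
    (2 ^ n : ℝ)⁻¹ * ∑ s : Fin n → Bool, ‖∑ j, boolSign (s j) • D (x j)‖ ^ q
      ≤ (kahaneConst q * C * n ^ (1 / p - 1 / q)) ^ q * ∑ j, a (x j) ^ q := by
  have hq0 : 0 < q := hp.trans_le hq
  have hκ := (kahaneConst_pos hq0).le
  have moment := h.signAverage_rpow_le hp hp2 ha hq0 (List.ofFn x)
  rw [List.map_ofFn, List.map_ofFn, signAverage_ofFn, List.sum_ofFn] at moment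
  simp only [zero_add, Function.comp_apply] at moment
  have sum_nonneg : 0 ≤ ∑ j, a (x j) ^ p := Finset.sum_nonneg fun j _ => Real.rpow_nonneg (ha _) p
  have power_mean := Real.rpow_sum_le_const_mul_sum_rpow_of_nonneg Finset.univ
    (f := fun j => a (x j) ^ p) ((one_le_div hp).2 hq) (fun j _ => Real.rpow_nonneg (ha _) p)
  simp only [← Real.rpow_mul (ha _), mul_div_cancel₀ _ hp.ne', Finset.card_univ,
    Fintype.card_fin] at power_mean
  calc _ ≤ (kahaneConst q * (C * (∑ j, a (x j) ^ p) ^ (1 / p))) ^ q := moment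
    _ = (kahaneConst q * C) ^ q * (∑ j, a (x j) ^ p) ^ (q / p) := by
        rw [← mul_assoc, Real.mul_rpow (by positivity) (by positivity), ← Real.rpow_mul sum_nonneg,
          one_div_mul_eq_div]
    _ ≤ (kahaneConst q * C) ^ q * (n ^ (q / p - 1) * ∑ j, a (x j) ^ q) := by gcongr
    _ = _ := by
        rw [Real.mul_rpow (mul_nonneg hκ hC) (by positivity), ← Real.rpow_mul n.cast_nonneg,
          sub_mul, one_div_mul_eq_div, one_div_mul_cancel hq0.ne', mul_assoc]

theorem sum_enorm_rpow_le (h : IsRademacherDominated p C D a) (hp : 0 < p) (hp2 : p ≤ 2)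
    (hq : p ≤ q) (hC : 0 ≤ C) (ha : ∀ s, 0 ≤ a s) {n : ℕ} (x : Fin n → S) :
    ∑ s : Fin n → Bool, ‖∑ j, boolSign (s j) • D (x j)‖ₑ ^ q
      ≤ 2 ^ n * (ENNReal.ofReal (kahaneConst q * C * n ^ (1 / p - 1 / q)) ^ q
        * ∑ j, ‖a (x j)‖ₑ ^ q) := by
  have hq0 : 0 < q := hp.trans_le hq
  have hκ := (kahaneConst_pos hq0).le
  have real_le := ENNReal.ofReal_le_ofReal
    ((inv_mul_le_iff₀ (by positivity)).1 (h.sum_norm_rpow_le hp hp2 hq hC ha x))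
  rw [ENNReal.ofReal_mul (by positivity), ENNReal.ofReal_mul (by positivity),
    ENNReal.ofReal_pow zero_le_two, ENNReal.ofReal_ofNat,
    ← ENNReal.ofReal_rpow_of_nonneg (by positivity) hq0.le,
    ENNReal.ofReal_sum_of_nonneg fun _ _ => by positivity,
    ENNReal.ofReal_sum_of_nonneg fun _ _ => Real.rpow_nonneg (ha _) q] at real_le
  simpa only [← ENNReal.ofReal_rpow_of_nonneg (norm_nonneg _) hq0.le, ofReal_norm,
    ← ENNReal.ofReal_rpow_of_nonneg (ha _) hq0.le, Real.enorm_of_nonneg (ha _)] using real_le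

end IsRademacherDominated

end RademacherDomination

section Symmetrization

variable {Ω : Type*} [MeasurableSpace Ω] {μ : Measure Ω} {T : Type*} [NormedAddCommGroup T]

theorem lintegral_enorm_rpow_eq_eLpNorm_rpow {q : ℝ} (hq : 0 < q) (f : Ω → T) :
    ∫⁻ ω, ‖f ω‖ₑ ^ q ∂μ = eLpNorm f (ENNReal.ofReal q) μ ^ q := by
  rw [eLpNorm_eq_eLpNorm' (by simpa using hq) ENNReal.ofReal_ne_top, ENNReal.toReal_ofReal hq.le,
    lintegral_rpow_enorm_eq_rpow_eLpNorm' hq]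

theorem aestronglyMeasurable_comp_pi_eval [IsProbabilityMeasure μ] {D : Ω → T} {n : ℕ}
    (hD : AEStronglyMeasurable D μ) (j : Fin n) :
    AEStronglyMeasurable (fun ω : Fin n → Ω => D (ω j)) (Measure.pi fun _ => μ) :=
  hD.comp_measurePreserving (measurePreserving_eval (fun _ => μ) j)

variable [NormedSpace ℝ T]

theorem eLpNorm_integral_right_le {Ω' : Type*} [MeasurableSpace Ω'] {ν : Measure Ω'} [SFinite μ]
    [IsProbabilityMeasure ν] {q : ℝ} (hq : 1 ≤ q) {F : Ω × Ω' → T}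
    (hF : AEStronglyMeasurable F (μ.prod ν)) :
    eLpNorm (fun ω => ∫ ω', F (ω, ω') ∂ν) (ENNReal.ofReal q) μ
      ≤ eLpNorm F (ENNReal.ofReal q) (μ.prod ν) := by
  have hq0 : 0 < q := by linarith
  rw [← ENNReal.rpow_le_rpow_iff hq0, ← lintegral_enorm_rpow_eq_eLpNorm_rpow hq0,
    ← lintegral_enorm_rpow_eq_eLpNorm_rpow hq0, lintegral_prod _ (hF.enorm.pow_const q)]
  refine lintegral_mono_ae ?_
  filter_upwards [hF.prodMk_left] with ω hω
  rw [lintegral_enorm_rpow_eq_eLpNorm_rpow hq0 fun ω' => F (ω, ω')]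
  gcongr
  calc ‖∫ ω', F (ω, ω') ∂ν‖ₑ
      ≤ ∫⁻ ω', ‖F (ω, ω')‖ₑ ∂ν := enorm_integral_le_lintegral_enorm _
    _ = eLpNorm (fun ω' => F (ω, ω')) 1 ν := eLpNorm_one_eq_lintegral_enorm.symm
    _ ≤ eLpNorm (fun ω' => F (ω, ω')) (ENNReal.ofReal q) ν :=
        eLpNorm_le_eLpNorm_of_exponent_le (by simpa using hq) hω

variable [IsProbabilityMeasure μ] {D : Ω → T} {n : ℕ} {q : ℝ}

theorem aestronglyMeasurable_sum_boolSign_smul (hD : AEStronglyMeasurable D μ)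
    (s : Fin n → Bool) :
    AEStronglyMeasurable (fun ω : Fin n → Ω => ∑ j, boolSign (s j) • D (ω j))
      (Measure.pi fun _ => μ) :=
  Finset.aestronglyMeasurable_fun_sum _ fun j _ =>
    (aestronglyMeasurable_comp_pi_eval hD j).const_smul (boolSign (s j))

theorem eLpNorm_sum_sub_integral_le_sum_sub_copy [CompleteSpace T] (hq : 1 ≤ q)
    (hD : Integrable D μ) :
    eLpNorm (fun ω : Fin n → Ω => ∑ j, (D (ω j) - ∫ x, D x ∂μ)) (ENNReal.ofReal q)
        (Measure.pi fun _ => μ)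
      ≤ eLpNorm (fun w : Fin n → Ω × Ω => ∑ j, (D (w j).1 - D (w j).2)) (ENNReal.ofReal q)
        (Measure.pi fun _ => μ.prod μ) := by
  let ν : Measure (Fin n → Ω) := Measure.pi fun _ => μ
  let F : (Fin n → Ω) × (Fin n → Ω) → T := fun w => ∑ j, (D (w.1 j) - D (w.2 j))
  have integrable_eval : ∀ j, Integrable (fun ω : Fin n → Ω => D (ω j)) ν := fun j =>
    (measurePreserving_eval (fun _ => μ) j).integrable_comp_of_integrable hD
  have F_meas : AEStronglyMeasurable F (ν.prod ν) :=
    Finset.aestronglyMeasurable_fun_sum _ fun j _ =>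
      (integrable_eval j).1.comp_fst.sub (integrable_eval j).1.comp_snd
  have integral_F : ∀ ω, ∫ ω', F (ω, ω') ∂ν = ∑ j, (D (ω j) - ∫ x, D x ∂μ) := by
    intro ω
    simp only [F]
    rw [integral_finsetSum _ fun j _ => by
      exact (integrable_const (D (ω j))).sub (integrable_eval j)]
    refine Finset.sum_congr rfl fun j _ => ?_
    rw [integral_sub (integrable_const _) (integrable_eval j), integral_const, probReal_univ,
      one_smul, integral_comp_eval (i := j) hD.1]
  simp only [← integral_F]
  exact (eLpNorm_integral_right_le hq F_meas).trans_eq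
    (eLpNorm_comp_measurePreserving F_meas
      (measurePreserving_arrowProdEquivProdArrow Ω Ω (Fin n) (fun _ => μ) fun _ => μ)).symm

/- Exchanging the two copies in the coordinates with sign `-1` preserves the product measure and
multiplies the `j`-th summand by `boolSign (s j)`. -/
theorem eLpNorm_sum_sub_copy_le (hq : 1 ≤ q) (hD : AEStronglyMeasurable D μ) (s : Fin n → Bool) :
    eLpNorm (fun w : Fin n → Ω × Ω => ∑ j, (D (w j).1 - D (w j).2)) (ENNReal.ofReal q)
        (Measure.pi fun _ => μ.prod μ)
      ≤ 2 * eLpNorm (fun ω : Fin n → Ω => ∑ j, boolSign (s j) • D (ω j)) (ENNReal.ofReal q)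
        (Measure.pi fun _ => μ) := by
  let ρ : Measure (Fin n → Ω × Ω) := Measure.pi fun _ => μ.prod μ
  let H : (Fin n → Ω) → T := fun ω => ∑ j, boolSign (s j) • D (ω j)
  have H_meas := aestronglyMeasurable_sum_boolSign_smul hD s
  have fst_pres : MeasurePreserving (fun (w : Fin n → Ω × Ω) j => (w j).1) ρ
      (Measure.pi fun _ => μ) := measurePreserving_pi _ _ fun _ => measurePreserving_fst
  have snd_pres : MeasurePreserving (fun (w : Fin n → Ω × Ω) j => (w j).2) ρ
      (Measure.pi fun _ => μ) := measurePreserving_pi _ _ fun _ => measurePreserving_snd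
  have swap_pres : MeasurePreserving
      (fun (w : Fin n → Ω × Ω) j => (if s j then id else Prod.swap) (w j)) ρ ρ := by
    refine measurePreserving_pi _ _ fun j => ?_
    cases s j
    · exact Measure.measurePreserving_swap
    · exact MeasurePreserving.id _
  have sum_meas : AEStronglyMeasurable
      (fun w : Fin n → Ω × Ω => ∑ j, (D (w j).1 - D (w j).2)) ρ :=
    Finset.aestronglyMeasurable_fun_sum _ fun j _ =>
      aestronglyMeasurable_comp_pi_eval (hD.comp_fst.sub hD.comp_snd) j
  have swap_eq : (fun w : Fin n → Ω × Ω => ∑ j, (D (w j).1 - D (w j).2)) ∘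
      (fun (w : Fin n → Ω × Ω) j => (if s j then id else Prod.swap) (w j))
      = H ∘ (fun w j => (w j).1) - H ∘ fun w j => (w j).2 := by
    ext w
    simp only [Function.comp_apply, H, Pi.sub_apply, ← Finset.sum_sub_distrib]
    refine Finset.sum_congr rfl fun j _ => ?_
    cases h : s j <;> simp [boolSign, neg_add_eq_sub]
  rw [← eLpNorm_comp_measurePreserving sum_meas swap_pres, swap_eq, two_mul,
    ← eLpNorm_comp_measurePreserving H_meas fst_pres]
  nth_rewrite 2 [eLpNorm_comp_measurePreserving H_meas fst_pres]
  rw [← eLpNorm_comp_measurePreserving H_meas snd_pres]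
  exact eLpNorm_sub_le (H_meas.comp_measurePreserving fst_pres)
    (H_meas.comp_measurePreserving snd_pres) (by simpa using hq)

end Symmetrization

section MonteCarlo

theorem eLpNorm_sum_sub_eq_of_identDistrib {ι Ω Ω' T : Type*} [Fintype ι] [MeasurableSpace Ω]
    [MeasurableSpace Ω'] [NormedAddCommGroup T] [MeasurableSpace T] [BorelSpace T]
    {μ : Measure Ω} {ν : Measure Ω'} {ξ : ι → Ω → T} {η : ι → Ω' → T}
    (h : IdentDistrib (fun ω i => ξ i ω) (fun ω i => η i ω) μ ν)
    (hξ : ∀ i, AEStronglyMeasurable (ξ i) μ) (c : T) (q : ℝ≥0∞) :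
    eLpNorm (fun ω => ∑ i, (ξ i ω - c)) q μ = eLpNorm (fun ω => ∑ i, (η i ω - c)) q ν := by
  have joint_law : HasLaw (fun ω i => ξ i ω) (μ.map fun ω i => ξ i ω) μ :=
    ⟨h.aemeasurable_fst, rfl⟩
  have coordinate_meas : ∀ i, AEStronglyMeasurable (fun x : ι → T => x i)
      (μ.map fun ω i => ξ i ω) := fun i =>
    have coordinate_law : HasLaw (fun x : ι → T => x i) _ (μ.map fun ω i => ξ i ω) :=
      ⟨(measurable_pi_apply i).aemeasurable, rfl⟩
    ((coordinate_law.fun_comp joint_law).identDistrib coordinate_law).aestronglyMeasurable_snd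
      (hξ i)
  have sum_meas : AEStronglyMeasurable (fun x : ι → T => ∑ i, (x i - c))
      (μ.map fun ω i => ξ i ω) :=
    Finset.aestronglyMeasurable_fun_sum _ fun i _ =>
      (coordinate_meas i).sub aestronglyMeasurable_const
  have push_fst := eLpNorm_map_measure (p := q) sum_meas h.aemeasurable_fst
  rw [h.map_eq] at sum_meas push_fst
  exact push_fst.symm.trans (eLpNorm_map_measure sum_meas h.aemeasurable_snd)

namespace IsRademacherDominated

variable {Ω T : Type*} [MeasurableSpace Ω] {μ : Measure Ω} [IsProbabilityMeasure μ]
  [NormedAddCommGroup T] [NormedSpace ℝ T] {p q C : ℝ} {D : Ω → T} {a : Ω → ℝ}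

theorem sum_eLpNorm_rpow_le (h : IsRademacherDominated p C D a) (hp : 0 < p) (hp2 : p ≤ 2)
    (hq : p ≤ q) (hC : 0 ≤ C) (ha : ∀ ω, 0 ≤ a ω) (ha_meas : AEStronglyMeasurable a μ)
    (hD : AEStronglyMeasurable D μ) (n : ℕ) :
    ∑ s : Fin n → Bool, eLpNorm (fun ω : Fin n → Ω => ∑ j, boolSign (s j) • D (ω j))
        (ENNReal.ofReal q) (Measure.pi fun _ => μ) ^ q
      ≤ 2 ^ n * (ENNReal.ofReal (kahaneConst q * C * n ^ (1 / p))
        * eLpNorm a (ENNReal.ofReal q) μ) ^ q := by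
  have hq0 : 0 < q := hp.trans_le hq
  have hκ := (kahaneConst_pos hq0).le
  have lintegral_a : ∀ j, ∫⁻ ω : Fin n → Ω, ‖a (ω j)‖ₑ ^ q ∂(Measure.pi fun _ => μ)
      = eLpNorm a (ENNReal.ofReal q) μ ^ q := fun j => by
    rw [lintegral_enorm_rpow_eq_eLpNorm_rpow hq0 fun ω : Fin n → Ω => a (ω j)]
    exact congrArg (· ^ q)
      (eLpNorm_comp_measurePreserving ha_meas (measurePreserving_eval (fun _ => μ) j))
  have n_eq : (n : ℝ≥0∞) = ENNReal.ofReal (n ^ (1 / q)) ^ q := by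
    rw [ENNReal.ofReal_rpow_of_nonneg (by positivity) hq0.le, ← Real.rpow_mul n.cast_nonneg,
      one_div_mul_cancel hq0.ne', Real.rpow_one, ENNReal.ofReal_natCast]
  have pow_n_eq : (n : ℝ) ^ (1 / p) = n ^ (1 / p - 1 / q) * n ^ (1 / q) := by
    rw [← Real.rpow_add' n.cast_nonneg (by rw [sub_add_cancel]; positivity), sub_add_cancel]
  simp only [← lintegral_enorm_rpow_eq_eLpNorm_rpow hq0]
  rw [← lintegral_finsetSum' _ fun s _ =>
    (aestronglyMeasurable_sum_boolSign_smul hD s).enorm.pow_const q]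
  refine (lintegral_mono fun ω => h.sum_enorm_rpow_le hp hp2 hq hC ha ω).trans_eq ?_
  rw [lintegral_const_mul' _ _ (by simp), lintegral_const_mul' _ _ (by finiteness),
    lintegral_finsetSum' _ fun j _ =>
      (aestronglyMeasurable_comp_pi_eval ha_meas j).enorm.pow_const q]
  simp only [lintegral_a, Finset.sum_const, Finset.card_univ, Fintype.card_fin, nsmul_eq_mul]
  rw [n_eq, pow_n_eq, ← mul_assoc (kahaneConst q * C), ← mul_assoc (ENNReal.ofReal _ ^ q),
    ← ENNReal.mul_rpow_of_nonneg _ _ hq0.le, ← ENNReal.mul_rpow_of_nonneg _ _ hq0.le,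
    ← ENNReal.ofReal_mul (by positivity)]

variable [CompleteSpace T]

theorem eLpNorm_sum_sub_integral_le (h : IsRademacherDominated p C D a) (hp : 1 ≤ p)
    (hp2 : p ≤ 2) (hq : p ≤ q) (hC : 0 ≤ C) (ha : ∀ ω, 0 ≤ a ω)
    (ha_meas : AEStronglyMeasurable a μ) (hD : Integrable D μ) (n : ℕ) :
    eLpNorm (fun ω : Fin n → Ω => ∑ j, (D (ω j) - ∫ x, D x ∂μ)) (ENNReal.ofReal q)
        (Measure.pi fun _ => μ)
      ≤ 2 * (ENNReal.ofReal (kahaneConst q * C * n ^ (1 / p))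
        * eLpNorm a (ENNReal.ofReal q) μ) := by
  have hq0 : 0 < q := by linarith
  rw [← ENNReal.rpow_le_rpow_iff hq0, ENNReal.mul_rpow_of_nonneg _ _ hq0.le]
  refine (ENNReal.mul_le_mul_iff_right (a := 2 ^ n) (by simp) (by simp)).1 ?_
  set A := eLpNorm (fun ω : Fin n → Ω => ∑ j, (D (ω j) - ∫ x, D x ∂μ)) (ENNReal.ofReal q)
    (Measure.pi fun _ => μ)
  set H : (Fin n → Bool) → (Fin n → Ω) → T := fun s ω => ∑ j, boolSign (s j) • D (ω j)
  have symmetrization_le : ∀ s, A ≤ 2 * eLpNorm (H s) (ENNReal.ofReal q) (Measure.pi fun _ => μ) :=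
    fun s => (eLpNorm_sum_sub_integral_le_sum_sub_copy (hp.trans hq) hD).trans
      (eLpNorm_sum_sub_copy_le (hp.trans hq) hD.1 s)
  calc 2 ^ n * A ^ q = ∑ _s : Fin n → Bool, A ^ q := by simp
    _ ≤ ∑ s, 2 ^ q * eLpNorm (H s) (ENNReal.ofReal q) (Measure.pi fun _ => μ) ^ q := by
        gcongr with s
        rw [← ENNReal.mul_rpow_of_nonneg _ _ hq0.le]
        gcongr
        exact symmetrization_le s
    _ ≤ 2 ^ q * (2 ^ n * _) := by
        rw [← Finset.mul_sum]
        gcongr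
        exact h.sum_eLpNorm_rpow_le (by linarith) hp2 hq hC ha ha_meas hD.1 n
    _ = _ := mul_left_comm _ _ _

theorem eLpNorm_monteCarlo_sub_le [MeasurableSpace T] [BorelSpace T]
    (h : IsRademacherDominated p C D a) (hp : 1 ≤ p) (hp2 : p ≤ 2) (hq : p ≤ q) (hC : 0 ≤ C)
    (ha : ∀ ω, 0 ≤ a ω) (ha_meas : AEStronglyMeasurable a μ) (hD : Integrable D μ)
    {ξ : ℕ → Ω → T} (hξ : ∀ j, IdentDistrib (ξ j) D μ μ) (hξ_indep : iIndepFun ξ μ)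
    {n : ℕ} (hn : n ≠ 0) :
    eLpNorm (fun ω => (n : ℝ)⁻¹ • ∑ j ∈ Finset.range n, ξ j ω - ∫ x, D x ∂μ)
        (ENNReal.ofReal q) μ
      ≤ ENNReal.ofReal (2 * kahaneConst q * C * n ^ (1 / p - 1))
        * eLpNorm a (ENNReal.ofReal q) μ := by
  have hn0 : (0 : ℝ) < n := by positivity
  have D_law : HasLaw D (μ.map D) μ := ⟨hD.aemeasurable, rfl⟩
  have identDistrib_pi : IdentDistrib (fun ω (j : Fin n) => ξ j ω)
      (fun (ω : Fin n → Ω) j => D (ω j)) μ (Measure.pi fun _ => μ) :=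
    IdentDistrib.pi
      (fun j => (hξ j).trans
        (D_law.identDistrib (D_law.fun_comp (measurePreserving_eval (fun _ => μ) j).hasLaw)))
      (hξ_indep.precomp Fin.val_injective) (iIndepFun_pi fun _ => hD.aemeasurable)
  have error_eq : (fun ω => (n : ℝ)⁻¹ • ∑ j ∈ Finset.range n, ξ j ω - ∫ x, D x ∂μ)
      = (n : ℝ)⁻¹ • fun ω => ∑ j : Fin n, (ξ j ω - ∫ x, D x ∂μ) := by
    ext1 ω
    simp only [Pi.smul_apply]
    rw [Finset.sum_sub_distrib, Finset.sum_const, Finset.card_univ, Fintype.card_fin, smul_sub,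
      ← Nat.cast_smul_eq_nsmul ℝ, inv_smul_smul₀ hn0.ne',
      Fin.sum_univ_eq_sum_range (fun j => ξ j ω) n]
  rw [error_eq, eLpNorm_const_smul, eLpNorm_sum_sub_eq_of_identDistrib identDistrib_pi
    fun j => (hξ j).symm.aestronglyMeasurable_snd hD.1]
  refine (mul_le_mul_right
    (h.eLpNorm_sum_sub_integral_le hp hp2 hq hC ha ha_meas hD n) _).trans_eq ?_
  rw [← mul_assoc, ← mul_assoc, Real.enorm_of_nonneg (by positivity), ← ENNReal.ofReal_ofNat 2,
    ← ENNReal.ofReal_mul (by positivity), ← ENNReal.ofReal_mul (by positivity),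
    Real.rpow_sub_one hn0.ne']
  congr 2
  ring

end IsRademacherDominated

end MonteCarlo

section SecondDifference

theorem abs_pow_sub_pow_sub_le_of_abs_le_one {u w u' w' δ : ℝ} (hu : |u| ≤ 1) (hw : |w| ≤ 1)
    (hu' : |u'| ≤ 1) (hw' : |w'| ≤ 1) (hδ : |u' - w'| ≤ δ) (hδ2 : δ ≤ 2) (k : ℕ) :
    |(u ^ k - w ^ k) - (u' ^ k - w' ^ k)|
      ≤ k ^ 2 * (δ * |u - u'| + |(u - w) - (u' - w')|) := by
  have hδ0 : 0 ≤ δ := (abs_nonneg _).trans hδ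
  have triangle : |w - w'| ≤ |u - u'| + |(u - w) - (u' - w')| := by
    rw [show w - w' = (u - u') - ((u - w) - (u' - w')) by ring]
    exact abs_sub _ _
  have first_difference (k : ℕ) {a b : ℝ} (ha : |a| ≤ 1) (hb : |b| ≤ 1) :
      |a ^ k - b ^ k| ≤ |a - b| * k :=
    (abs_pow_sub_pow_le a b k).trans (mul_le_of_le_one_right (by positivity)
      (pow_le_one₀ ((abs_nonneg a).trans (le_max_left _ _)) (max_le ha hb)))
  set Δ := |u - u'|
  set Δ' := |(u - w) - (u' - w')|
  have : 0 ≤ Δ := abs_nonneg _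
  have : 0 ≤ Δ' := abs_nonneg _
  induction k with
  | zero => simp
  | succ k ih =>
    have product_rule : (u ^ (k + 1) - w ^ (k + 1)) - (u' ^ (k + 1) - w' ^ (k + 1))
        = u * ((u ^ k - w ^ k) - (u' ^ k - w' ^ k)) + (u - u') * (u' ^ k - w' ^ k)
          + ((u - w) - (u' - w')) * w ^ k + (u' - w') * (w ^ k - w' ^ k) := by ring
    calc _ ≤ |u| * |(u ^ k - w ^ k) - (u' ^ k - w' ^ k)| + Δ * |u' ^ k - w' ^ k|
          + Δ' * |w| ^ k + |u' - w'| * |w ^ k - w' ^ k| := by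
          simp only [product_rule, Δ, Δ', ← abs_mul, ← abs_pow]
          exact (abs_add_le _ _).trans (by gcongr; exact abs_add_three _ _ _)
      _ ≤ 1 * (k ^ 2 * (δ * Δ + Δ')) + Δ * (δ * k) + Δ' * 1 + δ * ((Δ + Δ') * k) := by
          gcongr
          · exact (first_difference k hu' hw').trans (by gcongr)
          · exact pow_le_one₀ (abs_nonneg w) hw
          · exact (first_difference k hw hw').trans (by gcongr)
      _ ≤ _ := by
          have : δ * (Δ' * k) ≤ 2 * (Δ' * k) := by gcongr
          have : 0 ≤ δ * Δ := by positivity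
          push_cast
          nlinarith

theorem abs_pow_sub_pow_sub_le {u w u' w' δ m : ℝ} (hu : |u| ≤ m) (hw : |w| ≤ m)
    (hu' : |u'| ≤ m) (hw' : |w'| ≤ m) (hδ : |u' - w'| ≤ δ) (hδ2 : δ ≤ 2 * m) (k : ℕ) :
    |(u ^ k - w ^ k) - (u' ^ k - w' ^ k)|
      ≤ k ^ 2 * m ^ (k - 1) * (δ / m * |u - u'| + |(u - w) - (u' - w')|) := by
  rcases k with _ | k
  · simp
  rcases ((abs_nonneg u).trans hu).eq_or_lt with rfl | hm
  · simp only [abs_nonpos_iff] at hu hw hu' hw'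
    simp [hu, hw, hu', hw']
  have div_le_one {t : ℝ} (ht : |t| ≤ m) : |t / m| ≤ 1 := by
    rwa [abs_div, abs_of_pos hm, div_le_one hm]
  have scaled := abs_pow_sub_pow_sub_le_of_abs_le_one (δ := δ / m) (div_le_one hu) (div_le_one hw)
    (div_le_one hu') (div_le_one hw') (by rw [← sub_div, abs_div, abs_of_pos hm]; gcongr)
    (by rwa [div_le_iff₀ hm]) (k + 1)
  simp only [div_pow, ← sub_div, abs_div, abs_of_pos hm, abs_of_pos (pow_pos hm _)] at scaled
  rw [div_le_iff₀ (pow_pos hm _)] at scaled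
  refine scaled.trans_eq ?_
  rw [Nat.add_sub_cancel, pow_succ]
  field

end SecondDifference

section TensorPower

variable {E : Type*} [NormedAddCommGroup E] {k : ℕ}

/-- The quantity `max ‖x‖ ‖y‖ ^ (k - 1) * ‖x - y‖`, which controls the distance of the `k`-fold
tensor powers of `x` and `y`. -/
noncomputable def powDist (k : ℕ) (x y : E) : ℝ := max ‖x‖ ‖y‖ ^ (k - 1) * ‖x - y‖

theorem powDist_nonneg (x y : E) : 0 ≤ powDist k x y := by
  have := (norm_nonneg x).trans (le_max_left _ ‖y‖)
  unfold powDist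
  positivity

theorem continuous_powDist : Continuous fun z : E × E => powDist k z.1 z.2 := by
  unfold powDist
  fun_prop

variable [NormedSpace ℝ E]

/-- The closed unit ball of the dual space, over which the symmetric injective norm is a
supremum. -/
abbrev DualBall (E : Type*) [NormedAddCommGroup E] [NormedSpace ℝ E] : Type _ :=
  {f : E →L[ℝ] ℝ // ‖f‖ ≤ 1}

instance DualBall.instNonempty : Nonempty (DualBall E) := ⟨⟨0, by simp⟩⟩

theorem DualBall.abs_apply_le (f : DualBall E) (x : E) : |f.1 x| ≤ ‖x‖ :=
  (f.1.le_of_opNorm_le f.2 x).trans_eq (one_mul _)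

theorem continuous_evalPow (U : ⨂[ℝ] (_ : Fin k), E) :
    Continuous fun f : E →L[ℝ] ℝ => evalPow k f U := by
  induction U using PiTensorProduct.induction_on with
  | smul_tprod r x =>
    simp only [map_smul, evalPow_tprod]
    fun_prop
  | add U V hU hV =>
    simp only [map_add]
    fun_prop

theorem evalPow_symPow (f : E →L[ℝ] ℝ) (x : E) :
    evalPow k f (SymTensor.incl k E (symPow k x)) = f x ^ k :=
  (evalPow_tprod k f fun _ => x).trans (by simp)

theorem evalPow_zero (hk : k ≠ 0) (U : ⨂[ℝ] (_ : Fin k), E) :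
    evalPow k (0 : E →L[ℝ] ℝ) U = 0 := by
  induction U using PiTensorProduct.induction_on with
  | smul_tprod r x => simp [evalPow_tprod, hk]
  | add U V hU hV => rw [map_add, hU, hV, add_zero]

namespace SymTensor

theorem abs_evalPow_le_norm (U : SymTensor k E) (f : DualBall E) :
    |evalPow k f.1 (incl k E U)| ≤ ‖U‖ :=
  le_ciSup (evalPow_bddAbove k (incl k E U)) f

theorem norm_le {U : SymTensor k E} {C : ℝ}
    (h : ∀ f : DualBall E, |evalPow k f.1 (incl k E U)| ≤ C) : ‖U‖ ≤ C :=
  ciSup_le h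

end SymTensor

theorem norm_tensorPow_sub_le (x y : E) : ‖tensorPow k x - tensorPow k y‖ ≤ k * powDist k x y := by
  unfold tensorPow powDist
  rw [← UniformSpace.Completion.coe_sub, UniformSpace.Completion.norm_coe]
  refine SymTensor.norm_le fun f => ?_
  simp only [map_sub, evalPow_symPow]
  calc |f.1 x ^ k - f.1 y ^ k| ≤ |f.1 (x - y)| * k * max |f.1 x| |f.1 y| ^ (k - 1) := by
        rw [map_sub]
        exact abs_pow_sub_pow_le _ _ k
    _ ≤ ‖x - y‖ * k * max ‖x‖ ‖y‖ ^ (k - 1) := by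
        gcongr <;> exact f.abs_apply_le _
    _ = _ := by ring

theorem norm_tensorPow_le (x : E) : ‖tensorPow k x‖ ≤ ‖x‖ ^ k := by
  unfold tensorPow
  rw [UniformSpace.Completion.norm_coe]
  refine SymTensor.norm_le fun f => ?_
  rw [evalPow_symPow, abs_pow]
  exact pow_le_pow_left₀ (abs_nonneg _) (f.abs_apply_le x) k

theorem tensorPow_zero (hk : k ≠ 0) : tensorPow k (0 : E) = 0 := by
  rw [← norm_le_zero_iff]
  simpa [hk] using norm_tensorPow_le (k := k) (0 : E)

theorem continuous_tensorPow : Continuous (tensorPow k : E → SymInjTensor k E) := by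
  refine continuous_iff_continuousAt.2 fun x => tendsto_iff_norm_sub_tendsto_zero.2 ?_
  have bound : Continuous fun y : E => k * powDist k y x :=
    continuous_const.mul (continuous_powDist.comp (Continuous.prodMk_left x))
  refine squeeze_zero (fun _ => norm_nonneg _) (fun y => norm_tensorPow_sub_le y x) ?_
  simpa [powDist] using bound.tendsto x

end TensorPower

section DualBallFunctions

open scoped BoundedContinuousFunction

variable (k : ℕ) (E : Type*) [NormedAddCommGroup E] [NormedSpace ℝ E]

/-- A vector as the function `f ↦ f x` on the dual unit ball. -/
noncomputable def toDualBallFun : E →+ (DualBall E →ᵇ ℝ) :=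
  AddMonoidHom.mk' (fun x => .ofNormedAddCommGroup (fun f : DualBall E => f.1 x)
    (by fun_prop) ‖x‖ fun f => f.abs_apply_le x) fun x y => by ext f; exact map_add f.1 x y

variable {E} in
theorem norm_toDualBallFun_le (x : E) : ‖toDualBallFun E x‖ ≤ ‖x‖ :=
  BoundedContinuousFunction.norm_ofNormedAddCommGroup_le _ (norm_nonneg x) fun f =>
    f.abs_apply_le x

/-- A symmetric tensor as the function `f ↦ ⟨f ⊗ ⋯ ⊗ f, U⟩` on the dual unit ball. -/
noncomputable def SymTensor.toDualBallFun : SymTensor k E →+ (DualBall E →ᵇ ℝ) :=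
  AddMonoidHom.mk' (fun U => .ofNormedAddCommGroup (fun f => evalPow k f.1 (incl k E U))
    ((continuous_evalPow _).comp continuous_subtype_val) ‖U‖ U.abs_evalPow_le_norm) fun U V => by
      ext f; exact map_add (evalPow k f.1 ∘ₗ incl k E) U V

variable {k E} in
theorem SymTensor.norm_toDualBallFun (U : SymTensor k E) : ‖toDualBallFun k E U‖ = ‖U‖ :=
  BoundedContinuousFunction.norm_eq_iSup_norm _

end DualBallFunctions

section TensorPowerDomination

variable {E : Type*} [NormedAddCommGroup E] [NormedSpace ℝ E] {k : ℕ}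

/-- The multiple of `x` which, together with `diffMajorant k x y`, dominates the increments of
`f ↦ f x ^ k - f y ^ k` on the dual unit ball (at `x = y = 0` the quotient is `0 / 0 = 0`). -/
noncomputable def baseMajorant (k : ℕ) (x y : E) : E :=
  (2 * k ^ 2 * max ‖x‖ ‖y‖ ^ (k - 1) * (‖x - y‖ / max ‖x‖ ‖y‖)) • x

/-- The multiple of `x - y` which, together with `baseMajorant k x y`, dominates the increments of
`f ↦ f x ^ k - f y ^ k` on the dual unit ball. -/
noncomputable def diffMajorant (k : ℕ) (x y : E) : E :=
  (2 * k ^ 2 * max ‖x‖ ‖y‖ ^ (k - 1)) • (x - y)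

theorem norm_baseMajorant_le (x y : E) : ‖baseMajorant k x y‖ ≤ 2 * k ^ 2 * powDist k x y := by
  have hm : 0 ≤ max ‖x‖ ‖y‖ := (norm_nonneg x).trans (le_max_left _ _)
  rw [baseMajorant, powDist, norm_smul, Real.norm_of_nonneg (by positivity), mul_assoc,
    mul_assoc _ (_ ^ (k - 1))]
  refine mul_le_mul_of_nonneg_left (mul_le_mul_of_nonneg_left ?_ (by positivity)) (by positivity)
  rw [div_mul_eq_mul_div]
  exact div_le_of_le_mul₀ hm (norm_nonneg _) (by gcongr; exact le_max_left _ _)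

theorem norm_diffMajorant (x y : E) : ‖diffMajorant k x y‖ = 2 * k ^ 2 * powDist k x y := by
  have : 0 ≤ max ‖x‖ ‖y‖ := (norm_nonneg x).trans (le_max_left _ _)
  rw [diffMajorant, powDist, norm_smul, Real.norm_of_nonneg (by positivity), mul_assoc]

theorem abs_apply_pow_sub_sub_le_max (x y : E) (f g : DualBall E) :
    |(f.1 x ^ k - f.1 y ^ k) - (g.1 x ^ k - g.1 y ^ k)|
      ≤ max |f.1 (baseMajorant k x y) - g.1 (baseMajorant k x y)|
        |f.1 (diffMajorant k x y) - g.1 (diffMajorant k x y)| := by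
  have : 0 ≤ max ‖x‖ ‖y‖ := (norm_nonneg x).trans (le_max_left _ _)
  have bound_left (f : DualBall E) : |f.1 x| ≤ max ‖x‖ ‖y‖ :=
    (f.abs_apply_le x).trans (le_max_left _ _)
  have bound_right (f : DualBall E) : |f.1 y| ≤ max ‖x‖ ‖y‖ :=
    (f.abs_apply_le y).trans (le_max_right _ _)
  have second_difference := abs_pow_sub_pow_sub_le (bound_left f) (bound_right f) (bound_left g)
    (bound_right g) (δ := ‖x - y‖) (by simpa only [map_sub] using g.abs_apply_le (x - y))
    ((norm_sub_le x y).trans (by linarith [le_max_left ‖x‖ ‖y‖, le_max_right ‖x‖ ‖y‖])) k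
  simp only [baseMajorant, diffMajorant, map_smul, smul_eq_mul, ← mul_sub, abs_mul, map_sub]
  rw [abs_of_nonneg (a := ‖x - y‖ / max ‖x‖ ‖y‖) (by positivity),
    abs_of_nonneg (a := max ‖x‖ ‖y‖ ^ (k - 1)) (by positivity),
    abs_of_nonneg (a := (k : ℝ) ^ 2) (by positivity), abs_two, le_max_iff]
  by_contra! h
  linarith [h.1, h.2]

theorem signAverage_norm_tensorPow_sub_eq (L : List (E × E)) :
    signAverage (fun v => ‖v‖) (L.map fun z => tensorPow k z.1 - tensorPow k z.2) 0
      = signAverage (fun u => ‖u‖)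
        (L.map fun z => SymTensor.toDualBallFun k E (symPow k z.1 - symPow k z.2)) 0 := by
  have in_completion := signAverage_map (UniformSpace.Completion.toCompl (α := SymTensor k E))
    (fun v => ‖v‖) (L.map fun z => symPow k z.1 - symPow k z.2) 0
  have in_functions := signAverage_map (SymTensor.toDualBallFun k E)
    (fun v => ‖v‖) (L.map fun z => symPow k z.1 - symPow k z.2) 0
  simp only [UniformSpace.Completion.toCompl_apply, UniformSpace.Completion.norm_coe,
    SymTensor.norm_toDualBallFun, map_zero, List.map_map, Function.comp_def,
    UniformSpace.Completion.coe_sub] at in_completion in_functions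
  exact in_completion.trans in_functions.symm

theorem signAverage_norm_tensorPow_sub_le (hk : k ≠ 0) (L : List (E × E)) :
    signAverage (fun v => ‖v‖) (L.map fun z => tensorPow k z.1 - tensorPow k z.2) 0
      ≤ 2 * signAverage (fun v => ‖v‖)
        (L.flatMap fun z => [baseMajorant k z.1 z.2, diffMajorant k z.1 z.2]) 0 := by
  have contraction := signAverage_norm_map_le
    (φ := fun z : E × E => SymTensor.toDualBallFun k E (symPow k z.1 - symPow k z.2))
    (a := fun z => toDualBallFun E (baseMajorant k z.1 z.2))
    (b := fun z => toDualBallFun E (diffMajorant k z.1 z.2)) (i₀ := ⟨0, by simp⟩)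
    (fun z => evalPow_zero hk (SymTensor.incl k E (symPow k z.1 - symPow k z.2)))
    (fun z f g => by
      have increments_le := abs_apply_pow_sub_sub_le_max (k := k) z.1 z.2 f g
      simp only [← evalPow_symPow, ← map_sub] at increments_le
      exact increments_le) L
  rw [signAverage_norm_tensorPow_sub_eq]
  refine contraction.trans (mul_le_mul_of_nonneg_left ?_ zero_le_two)
  have from_vectors := signAverage_map (toDualBallFun E) (fun v => ‖v‖)
    (L.flatMap fun z => [baseMajorant k z.1 z.2, diffMajorant k z.1 z.2]) 0
  rw [map_zero, List.map_flatMap] at from_vectors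
  exact from_vectors.le.trans (signAverage_mono norm_toDualBallFun_le _ _)

theorem HasRademacherTypeWith.signAverage_norm_flatMap_pair_le {p τ c : ℝ}
    (hE : HasRademacherTypeWith p τ E) (hp : 1 ≤ p) (hτ : 0 ≤ τ) (hc : 0 ≤ c) {S : Type*}
    {u v : S → E} {a : S → ℝ} (ha : ∀ s, 0 ≤ a s) (hu : ∀ s, ‖u s‖ ≤ c * a s)
    (hv : ∀ s, ‖v s‖ ≤ c * a s) (L : List S) :
    signAverage (fun v => ‖v‖) (L.flatMap fun s => [u s, v s]) 0
      ≤ τ * (2 * c * (L.map fun s => a s ^ p).sum ^ (1 / p)) := by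
  have hp0 : 0 < p := one_pos.trans_le hp
  have pair_le (s : S) : ‖u s‖ ^ p + ‖v s‖ ^ p ≤ (2 * c) ^ p * a s ^ p := by
    have two_le : (2 : ℝ) ≤ 2 ^ p := by
      simpa using Real.rpow_le_rpow_of_exponent_le (x := 2) one_le_two hp
    calc ‖u s‖ ^ p + ‖v s‖ ^ p ≤ (c * a s) ^ p + (c * a s) ^ p := by gcongr; exacts [hu s, hv s]
      _ = 2 * (c * a s) ^ p := (two_mul _).symm
      _ ≤ 2 ^ p * (c * a s) ^ p := by have := ha s; gcongr
      _ = _ := by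
        rw [← Real.mul_rpow zero_le_two (mul_nonneg hc (ha s)), ← mul_assoc,
          Real.mul_rpow (by positivity) (ha s)]
  have sum_le : ((L.flatMap fun s => [u s, v s]).map fun x => ‖x‖ ^ p).sum
      ≤ (2 * c) ^ p * (L.map fun s => a s ^ p).sum := by
    rw [List.map_flatMap, List.flatMap_def, List.sum_flatten, List.map_map,
      ← List.sum_map_mul_left]
    exact List.sum_le_sum fun s _ => by simpa using pair_le s
  have root_le := Real.rpow_le_rpow (z := 1 / p) (sum_map_rpow_nonneg norm_nonneg p _) sum_le
    (by positivity)
  rw [Real.mul_rpow (by positivity) (sum_map_rpow_nonneg ha p L), one_div,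
    Real.rpow_rpow_inv (by positivity) hp0.ne', ← one_div] at root_le
  exact (hE.signAverage_norm_le hp _).trans (mul_le_mul_of_nonneg_left root_le hτ)

theorem HasRademacherTypeWith.isRademacherDominated_tensorPow_sub {p τ : ℝ}
    (hE : HasRademacherTypeWith p τ E) (hp : 1 ≤ p) (hτ : 0 ≤ τ) (hk : k ≠ 0) :
    IsRademacherDominated p (8 * τ * k ^ 2)
      (fun z : E × E => tensorPow k z.1 - tensorPow k z.2) (fun z => powDist k z.1 z.2) := by
  intro L
  refine (signAverage_norm_tensorPow_sub_le hk L).trans ?_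
  have vectors_le := hE.signAverage_norm_flatMap_pair_le hp hτ (c := 2 * k ^ 2) (by positivity)
    (a := fun z : E × E => powDist k z.1 z.2) (fun z => powDist_nonneg z.1 z.2)
    (fun z => norm_baseMajorant_le z.1 z.2) (fun z => (norm_diffMajorant z.1 z.2).le) L
  linarith

end TensorPowerDomination

section MomentsOfTensorPowers

variable {Ω E : Type*} [MeasurableSpace Ω] [NormedAddCommGroup E] {μ : Measure Ω} {k : ℕ}

theorem eLpNorm_norm_pow_mul_norm_le {F : Type*} [NormedAddCommGroup F] {f : Ω → E} {g : Ω → F}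
    (hf : AEStronglyMeasurable f μ) (hg : AEStronglyMeasurable g μ) (m : ℕ) (r : ℝ≥0∞) :
    eLpNorm (fun ω => ‖f ω‖ ^ m * ‖g ω‖) r μ
      ≤ eLpNorm f ((m + 1) * r) μ ^ m * eLpNorm g ((m + 1) * r) μ := by
  rcases eq_or_ne m 0 with rfl | hm
  · simp
  have hm0 : (m : ℝ≥0∞) ≠ 0 := by exact_mod_cast hm
  have : ENNReal.HolderTriple ((m + 1) * r / m) ((m + 1) * r) r := ⟨by
    rw [ENNReal.inv_div (.inl (ENNReal.natCast_ne_top m)) (.inl hm0), ← one_div,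
      ENNReal.div_add_div_same, ← mul_one (m + 1 : ℝ≥0∞), mul_assoc,
      ENNReal.mul_div_mul_left _ _ (by simp) (by finiteness), one_mul, one_div]⟩
  have holder := eLpNorm_smul_le_mul_eLpNorm (r := r) (p := (m + 1) * r / m) (q := (m + 1) * r)
    hg.norm (hf.norm.pow m)
  have power := eLpNorm_norm_rpow (p := (m + 1) * r / m) (μ := μ) (q := (m : ℝ)) f (by positivity)
  rw [ENNReal.ofReal_natCast, ENNReal.div_mul_cancel hm0 (ENNReal.natCast_ne_top m)] at power
  simp only [Real.rpow_natCast, ENNReal.rpow_natCast] at power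
  rw [← power, ← eLpNorm_norm g]
  exact holder

theorem eLpNorm_powDist_le (hk : k ≠ 0) {r : ℝ≥0∞} (hr : 1 ≤ r) {X Y : Ω → E}
    (hX : AEStronglyMeasurable X μ) (hY : AEStronglyMeasurable Y μ) {S : ℝ≥0∞}
    (hXS : eLpNorm X (k * r) μ ≤ S) (hYS : eLpNorm Y (k * r) μ ≤ S) :
    eLpNorm (fun ω => powDist k (X ω) (Y ω)) r μ
      ≤ (2 * S) ^ (k - 1) * eLpNorm (fun ω => X ω - Y ω) (k * r) μ := by
  obtain ⟨m, rfl⟩ := Nat.exists_eq_succ_of_ne_zero hk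
  simp only [Nat.succ_eq_add_one, Nat.cast_add, Nat.cast_one] at *
  have norm_sum_le : eLpNorm (fun ω => ‖X ω‖ + ‖Y ω‖) ((m + 1) * r) μ ≤ 2 * S := by
    refine (eLpNorm_add_le hX.norm hY.norm (one_le_mul le_add_self hr)).trans ?_
    rw [eLpNorm_norm, eLpNorm_norm, two_mul]
    exact add_le_add hXS hYS
  calc eLpNorm (fun ω => powDist (m + 1) (X ω) (Y ω)) r μ
      ≤ eLpNorm (fun ω => ‖‖X ω‖ + ‖Y ω‖‖ ^ m * ‖X ω - Y ω‖) r μ := by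
        refine eLpNorm_mono_real fun ω => ?_
        rw [Real.norm_of_nonneg (powDist_nonneg _ _), Real.norm_of_nonneg (by positivity)]
        unfold powDist
        exact mul_le_mul_of_nonneg_right (pow_le_pow_left₀ (le_max_of_le_left (norm_nonneg _))
          (max_le_add_of_nonneg (norm_nonneg _) (norm_nonneg _)) m) (norm_nonneg _)
    _ ≤ eLpNorm (fun ω => ‖X ω‖ + ‖Y ω‖) ((m + 1) * r) μ ^ m
          * eLpNorm (fun ω => X ω - Y ω) ((m + 1) * r) μ :=
        eLpNorm_norm_pow_mul_norm_le (hX.norm.add hY.norm) (hX.sub hY) m r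
    _ ≤ _ := by rw [Nat.add_sub_cancel]; gcongr

theorem integrable_tensorPow [NormedSpace ℝ E] [IsFiniteMeasure μ] {X : Ω → E} (hX : MemLp X k μ) :
    Integrable (fun ω => tensorPow k (X ω)) μ :=
  hX.integrable_norm_pow'.mono' (continuous_tensorPow.comp_aestronglyMeasurable hX.1)
    (.of_forall fun _ => norm_tensorPow_le _)

end MomentsOfTensorPowers

section LevelChoice

variable {A α β γ p' : ℝ}

theorem geom_sum_Icc_one_le_of_lt_one {r : ℝ} (hr : 0 ≤ r) (hr1 : r < 1) (L : ℕ) :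
    ∑ l ∈ Finset.Icc 1 L, r ^ l ≤ (1 - r)⁻¹ := by
  have : 0 < 1 - r := sub_pos.2 hr1
  calc ∑ l ∈ Finset.Icc 1 L, r ^ l ≤ r ^ 1 / (1 - r) := by
        rw [← Finset.Ico_add_one_right_eq_Icc]
        exact geom_sum_Ico_le_of_lt_one hr hr1
    _ ≤ (1 - r)⁻¹ := by rw [pow_one, ← one_div]; gcongr

theorem geom_sum_Icc_one_le_of_one_lt {r : ℝ} (hr : 1 < r) (L : ℕ) :
    ∑ l ∈ Finset.Icc 1 L, r ^ l ≤ r / (r - 1) * r ^ L := by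
  have : 0 < r - 1 := sub_pos.2 hr
  calc ∑ l ∈ Finset.Icc 1 L, r ^ l = (r ^ (L + 1) - r ^ 1) / (r - 1) := by
        rw [← Finset.Ico_add_one_right_eq_Icc, geom_sum_Ico hr.ne' (by lia)]
    _ ≤ r ^ (L + 1) / (r - 1) := by gcongr; linarith
    _ = r / (r - 1) * r ^ L := by ring

theorem natCeil_rpow_rpow_neg_one_div_le_inv {x : ℝ} (hx : 0 < x) (hp' : 0 < p') :
    (⌈x ^ p'⌉₊ : ℝ) ^ (-(1 / p')) ≤ x⁻¹ := by
  calc (⌈x ^ p'⌉₊ : ℝ) ^ (-(1 / p')) ≤ (x ^ p') ^ (-(1 / p')) :=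
        Real.rpow_le_rpow_of_nonpos (by positivity) (Nat.le_ceil _) (neg_nonpos.2 (by positivity))
    _ = x⁻¹ := by
        rw [← Real.rpow_mul hx.le, mul_neg, mul_one_div_cancel hp'.ne', Real.rpow_neg_one]

/-- The sample sizes are `Mᵢ = ⌈(S eᵢ / (δ wᵢ))^p'⌉` with `wᵢ = (eᵢ^p' cᵢ)^(1/(p'+1))` and
`S = ∑ wᵢ`: up to rounding, these minimize the cost under the constraint on the error. -/
theorem exists_sampleSizes_error_le_and_cost_le {ι : Type*} (s : Finset ι) {δ : ℝ} (hp' : 0 < p')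
    (hδ : 0 < δ) {e c : ι → ℝ} (he : ∀ i, 0 < e i) (hc : ∀ i, 0 < c i) :
    ∃ M : ι → ℕ, (∀ i ∈ s, 1 ≤ M i) ∧ ∑ i ∈ s, (M i : ℝ) ^ (-(1 / p')) * e i ≤ δ ∧
      ∑ i ∈ s, M i * c i
        ≤ δ ^ (-p') * (∑ i ∈ s, (e i ^ p' * c i) ^ (1 / (p' + 1))) ^ (p' + 1) + ∑ i ∈ s, c i := by
  set w : ι → ℝ := fun i => (e i ^ p' * c i) ^ (1 / (p' + 1)) with w_def
  have w_pos i : 0 < w i := by have := he i; have := hc i; positivity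
  have w_rpow i : e i ^ p' * c i = w i * w i ^ p' := by
    have := he i; have := hc i
    rw [mul_comm (w i), ← Real.rpow_add_one (w_pos i).ne', w_def, one_div,
      Real.rpow_inv_rpow (by positivity) (by positivity)]
  set S := ∑ i ∈ s, w i
  have S_pos {i} (hi : i ∈ s) : 0 < S := Finset.sum_pos (fun i _ => w_pos i) ⟨i, hi⟩
  set x : ι → ℝ := fun i => S * e i / (δ * w i) with x_def
  have x_pos {i} (hi : i ∈ s) : 0 < x i := by
    have := S_pos hi; have := he i; have := w_pos i; positivity
  refine ⟨fun i => ⌈x i ^ p'⌉₊, fun i hi => Nat.ceil_pos.2 (Real.rpow_pos_of_pos (x_pos hi) _),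
    ?_, ?_⟩
  · have error_le {i} (hi : i ∈ s) :
        (⌈x i ^ p'⌉₊ : ℝ) ^ (-(1 / p')) * e i ≤ δ / S * w i := by
      have := S_pos hi; have := he i; have := w_pos i
      refine (mul_le_mul_of_nonneg_right (natCeil_rpow_rpow_neg_one_div_le_inv (x_pos hi) hp')
        (he i).le).trans_eq ?_
      rw [x_def]
      field_simp
    calc ∑ i ∈ s, (⌈x i ^ p'⌉₊ : ℝ) ^ (-(1 / p')) * e i ≤ ∑ i ∈ s, δ / S * w i :=
          Finset.sum_le_sum fun i hi => error_le hi
      _ = δ * (S / S) := by rw [← Finset.mul_sum]; ring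
      _ ≤ δ := mul_le_of_le_one_right hδ.le (div_self_le_one S)
  · have cost_le {i} (hi : i ∈ s) : ⌈x i ^ p'⌉₊ * c i ≤ δ ^ (-p') * S ^ p' * w i + c i := by
      have := S_pos hi; have := he i; have := w_pos i; have := hc i
      calc ⌈x i ^ p'⌉₊ * c i ≤ (x i ^ p' + 1) * c i := by
            gcongr
            exact (Nat.ceil_lt_add_one (Real.rpow_pos_of_pos (x_pos hi) p').le).le
        _ = S ^ p' * (e i ^ p' * c i) / (δ ^ p' * w i ^ p') + c i := by
            rw [x_def, Real.div_rpow (by positivity) (by positivity),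
              Real.mul_rpow (by positivity) (by positivity),
              Real.mul_rpow (by positivity) (by positivity)]
            ring
        _ = δ ^ (-p') * S ^ p' * w i + c i := by
            rw [w_rpow, Real.rpow_neg hδ.le]
            field_simp
    have S_nonneg : 0 ≤ S := Finset.sum_nonneg fun i _ => (w_pos i).le
    refine (Finset.sum_le_sum fun i hi => cost_le hi).trans_eq ?_
    rw [Finset.sum_add_distrib, ← Finset.mul_sum, mul_assoc,
      Real.rpow_add_one' S_nonneg (by positivity)]

theorem exists_level {a : ℝ} (hA : 1 < A) (hα : 0 < α) (ha : 0 ≤ a) :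
    ∃ C, 1 ≤ C ∧ ∀ ε : ℝ, 0 < ε → ε ≤ 1 → ∃ L : ℕ, 1 ≤ L ∧
      a * A ^ (-(α * L)) < ε / 2 ∧ A ^ (α * L) ≤ C * ε⁻¹ := by
  have hA0 : 0 < A := one_pos.trans hA
  have one_le : 1 ≤ A ^ α * (2 * a + 1) :=
    one_le_mul_of_one_le_of_one_le (Real.one_le_rpow hA.le hα.le) (by linarith)
  refine ⟨A ^ α * (2 * a + 1), one_le, fun ε hε hε1 => ?_⟩
  set t := Real.logb A ((2 * a + 1) / ε)
  have t_nonneg : 0 ≤ t / α :=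
    div_nonneg (Real.logb_nonneg hA ((one_le_div hε).2 (by linarith))) hα.le
  have rpow_t : A ^ t = (2 * a + 1) / ε := Real.rpow_logb hA0 hA.ne' (by positivity)
  refine ⟨⌊t / α⌋₊ + 1, by lia, ?_, ?_⟩
  · have t_lt : t < α * (⌊t / α⌋₊ + 1 : ℕ) := by
      rw [← div_lt_iff₀' hα]
      exact_mod_cast Nat.lt_floor_add_one _
    have lt_rpow := Real.rpow_lt_rpow_of_exponent_lt hA t_lt
    rw [rpow_t, div_lt_iff₀ hε] at lt_rpow
    rw [Real.rpow_neg hA0.le, ← div_eq_mul_inv, div_lt_iff₀ (by positivity)]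
    linarith
  · have le_t : α * (⌊t / α⌋₊ + 1 : ℕ) ≤ α + t := by
      have floor_le := (le_div_iff₀' hα).1 (Nat.floor_le t_nonneg)
      push_cast
      linarith
    calc A ^ (α * (⌊t / α⌋₊ + 1 : ℕ)) ≤ A ^ (α + t) := Real.rpow_le_rpow_of_exponent_le hA.le le_t
      _ = _ := by rw [Real.rpow_add hA0, rpow_t]; ring

section FinestLevel

variable {C ε : ℝ} {L : ℕ}

theorem rpow_mul_le_of_rpow_mul_le (hA : 0 < A) (hα : 0 < α) (hC : 0 < C) (hε : 0 < ε)
    (hL : A ^ (α * L) ≤ C * ε⁻¹) {s : ℝ} (hs : 0 ≤ s) :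
    A ^ (s * L) ≤ C ^ (s / α) * ε ^ (-(s / α)) := by
  calc A ^ (s * L) = (A ^ (α * L)) ^ (s / α) := by
        rw [← Real.rpow_mul hA.le]
        field_simp
    _ ≤ (C * ε⁻¹) ^ (s / α) := by gcongr
    _ = C ^ (s / α) * ε ^ (-(s / α)) := by
        rw [Real.mul_rpow hC.le (by positivity), Real.inv_rpow hε.le, Real.rpow_neg hε.le]

theorem natCast_le_mul_abs_logb_of_rpow_mul_le (hA : 1 < A) (hα : 0 < α) (hC : 1 ≤ C) (hε : 0 < ε)
    (hε2 : ε ≤ 1 / 2) (hL : A ^ (α * L) ≤ C * ε⁻¹) :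
    L ≤ (Real.logb A C / Real.logb A 2 + 1) / α * |Real.logb A ε| := by
  have logb_two_pos : 0 < Real.logb A 2 := Real.logb_pos hA one_lt_two
  have logb_two_le : Real.logb A 2 ≤ -Real.logb A ε := by
    rw [← Real.logb_inv]
    refine Real.logb_le_logb_of_le hA two_pos ?_
    rw [le_inv_comm₀ two_pos hε, ← one_div]
    exact hε2
  have mul_le : α * L ≤ Real.logb A C - Real.logb A ε := by
    rw [← Real.logb_div (by positivity) hε.ne', Real.le_logb_iff_rpow_le hA (by positivity),
      div_eq_mul_inv]
    exact hL
  have logb_C_le : Real.logb A C ≤ Real.logb A C / Real.logb A 2 * -Real.logb A ε := by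
    rw [div_mul_eq_mul_div, le_div_iff₀ logb_two_pos]
    exact mul_le_mul_of_nonneg_left logb_two_le (Real.logb_nonneg hA hC)
  rw [abs_of_nonpos (by linarith), div_mul_eq_mul_div, le_div_iff₀ hα]
  linarith

end FinestLevel

theorem sum_rpow_mul_le_of_pos (hA : 1 < A) {s : ℝ} (hs : 0 < s) (L : ℕ) :
    ∑ l ∈ Finset.Icc 1 L, A ^ (s * l) ≤ A ^ s / (A ^ s - 1) * A ^ (s * L) := by
  simp only [Real.rpow_mul_natCast (one_pos.trans hA).le]
  exact geom_sum_Icc_one_le_of_one_lt (Real.one_lt_rpow hA hs) L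

theorem sum_rpow_mul_le_of_neg (hA : 1 < A) {s : ℝ} (hs : s < 0) (L : ℕ) :
    ∑ l ∈ Finset.Icc 1 L, A ^ (s * l) ≤ (1 - A ^ s)⁻¹ := by
  have hA0 : 0 < A := one_pos.trans hA
  simp only [Real.rpow_mul_natCast hA0.le]
  exact geom_sum_Icc_one_le_of_lt_one (by positivity) (Real.rpow_lt_one_of_one_lt_of_neg hA hs) L

/-- The order of the cost of the optimal real-valued sample sizes. Rounding them up adds at most one
sample per level, which accounts for the remaining term `ε ^ (-(γ / α))` of `costRate`. -/
noncomputable def samplingCostRate (α β γ A p' ε : ℝ) : ℝ :=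
  if γ < β * p' then ε ^ (-p')
  else if β * p' = γ then ε ^ (-p') * |Real.logb A ε| ^ (p' + 1)
  else ε ^ (-p' - (γ - β * p') / α)

theorem costRate_eq_add_samplingCostRate (ε : ℝ) :
    costRate α β γ A p' ε = ε ^ (-(γ / α)) + samplingCostRate α β γ A p' ε := by
  unfold costRate samplingCostRate
  split_ifs <;> rfl

theorem samplingCostRate_nonneg {ε : ℝ} (hε : 0 ≤ ε) : 0 ≤ samplingCostRate α β γ A p' ε := by
  unfold samplingCostRate
  split_ifs <;> positivity

theorem exists_rpow_mul_sum_rpow_le_samplingCostRate (hA : 1 < A) (hα : 0 < α) (hp' : 0 < p')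
    {C : ℝ} (hC : 1 ≤ C) :
    ∃ K, 0 < K ∧ ∀ (ε : ℝ) (L : ℕ), 0 < ε → ε ≤ 1 / 2 → A ^ (α * L) ≤ C * ε⁻¹ →
      ε ^ (-p') * (∑ l ∈ Finset.Icc 1 L, A ^ ((γ - β * p') / (p' + 1) * l)) ^ (p' + 1)
        ≤ K * samplingCostRate α β γ A p' ε := by
  have hA0 : 0 < A := one_pos.trans hA
  set s := (γ - β * p') / (p' + 1) with s_def
  rcases lt_trichotomy γ (β * p') with h | h | h
  · have s_neg : s < 0 := div_neg_of_neg_of_pos (by linarith) (by positivity)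
    have one_sub_pos : 0 < 1 - A ^ s := sub_pos.2 (Real.rpow_lt_one_of_one_lt_of_neg hA s_neg)
    refine ⟨(1 - A ^ s)⁻¹ ^ (p' + 1), by positivity, fun ε L hε _ _ => ?_⟩
    rw [samplingCostRate, if_pos h, mul_comm]
    gcongr
    exact sum_rpow_mul_le_of_neg hA s_neg L
  · set C' := (Real.logb A C / Real.logb A 2 + 1) / α
    have C'_pos : 0 < C' := by
      have := Real.logb_nonneg hA hC; have := Real.logb_pos hA one_lt_two; positivity
    refine ⟨C' ^ (p' + 1), by positivity, fun ε L hε hε2 hL => ?_⟩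
    rw [samplingCostRate, if_neg h.not_lt, if_pos h.symm, mul_left_comm,
      ← Real.mul_rpow C'_pos.le (abs_nonneg _), s_def, sub_eq_zero.2 h, zero_div]
    simp only [zero_mul, Real.rpow_zero, Finset.sum_const, Nat.card_Icc, Nat.add_sub_cancel,
      nsmul_eq_mul, mul_one]
    gcongr
    exact natCast_le_mul_abs_logb_of_rpow_mul_le hA hα hC hε hε2 hL
  · have s_pos : 0 < s := div_pos (by linarith) (by positivity)
    have sub_one_pos : 0 < A ^ s - 1 := sub_pos.2 (Real.one_lt_rpow hA s_pos)
    refine ⟨(A ^ s / (A ^ s - 1)) ^ (p' + 1) * C ^ ((γ - β * p') / α), by positivity,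
      fun ε L hε _ hL => ?_⟩
    rw [samplingCostRate, if_neg h.not_gt, if_neg h.ne, sub_eq_add_neg (-p'), Real.rpow_add hε,
      mul_left_comm]
    gcongr ?_ * ?_
    calc (∑ l ∈ Finset.Icc 1 L, A ^ (s * l)) ^ (p' + 1)
        ≤ (A ^ s / (A ^ s - 1) * A ^ (s * L)) ^ (p' + 1) := by
          gcongr
          exact sum_rpow_mul_le_of_pos hA s_pos L
      _ = (A ^ s / (A ^ s - 1)) ^ (p' + 1) * A ^ ((γ - β * p') * L) := by
          rw [Real.mul_rpow (by positivity) (by positivity), ← Real.rpow_mul hA0.le, s_def]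
          congr 2
          field_simp
      _ ≤ _ := by
          rw [mul_assoc]
          gcongr
          exact rpow_mul_le_of_rpow_mul_le hA0 hα (by positivity) hε hL (by linarith)

theorem exists_sampling_cost_le_costRate (hA : 1 < A) (hα : 0 < α) (hγ : 0 < γ) (hp' : 0 < p')
    {C b : ℝ} (hC : 1 ≤ C) (hb : 0 < b) :
    ∃ K, 0 < K ∧ ∀ (ε : ℝ) (L : ℕ), 0 < ε → ε ≤ 1 / 2 → A ^ (α * L) ≤ C * ε⁻¹ →
      (b * ε) ^ (-p') * (∑ l ∈ Finset.Icc 1 L, A ^ ((γ - β * p') / (p' + 1) * l)) ^ (p' + 1)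
        + ∑ l ∈ Finset.Icc 1 L, A ^ (γ * l) ≤ K * costRate α β γ A p' ε := by
  have hA0 : 0 < A := one_pos.trans hA
  obtain ⟨K, K_pos, le_samplingCostRate⟩ :=
    exists_rpow_mul_sum_rpow_le_samplingCostRate (β := β) (γ := γ) hA hα hp' hC
  have sub_one_pos : 0 < A ^ γ - 1 := sub_pos.2 (Real.one_lt_rpow hA hγ)
  set K' := A ^ γ / (A ^ γ - 1) * C ^ (γ / α)
  refine ⟨b ^ (-p') * K + K', by positivity, fun ε L hε hε2 hL => ?_⟩
  have sampling_le := le_samplingCostRate ε L hε hε2 hL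
  have rounding_le : ∑ l ∈ Finset.Icc 1 L, A ^ (γ * l) ≤ K' * ε ^ (-(γ / α)) := by
    refine (sum_rpow_mul_le_of_pos hA hγ L).trans ?_
    rw [mul_assoc]
    gcongr
    exact rpow_mul_le_of_rpow_mul_le hA0 hα (by positivity) hε hL hγ.le
  rw [Real.mul_rpow hb.le hε.le, mul_assoc]
  calc _ ≤ b ^ (-p') * (K * samplingCostRate α β γ A p' ε) + K' * ε ^ (-(γ / α)) := by gcongr
    _ ≤ (b ^ (-p') * K + K') * costRate α β γ A p' ε := by
        rw [costRate_eq_add_samplingCostRate]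
        have : 0 ≤ samplingCostRate α β γ A p' ε := samplingCostRate_nonneg hε.le
        have : 0 ≤ b ^ (-p') * K * ε ^ (-(γ / α)) := by positivity
        have : 0 ≤ K' * samplingCostRate α β γ A p' ε := by positivity
        linarith

theorem exists_levels_and_sampleSizes {a b : ℝ} (hA : 1 < A) (hα : 0 < α) (hγ : 0 < γ)
    (hp' : 0 < p') (ha : 0 ≤ a) (hb : 0 < b) :
    ∃ K, 0 < K ∧ ∀ ε : ℝ, 0 < ε → ε ≤ 1 / 2 → ∃ (L : ℕ) (M : ℕ → ℕ), 1 ≤ L ∧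
      (∀ l ∈ Finset.Icc 1 L, 1 ≤ M l) ∧
      a * A ^ (-(α * L)) + b * ∑ l ∈ Finset.Icc 1 L, (M l : ℝ) ^ (-(1 / p')) * A ^ (-(β * l)) < ε ∧
      mlmcCost (fun l => A ^ (γ * l)) L M ≤ K * costRate α β γ A p' ε := by
  have hA0 : 0 < A := one_pos.trans hA
  obtain ⟨C, one_le_C, exists_L⟩ := exists_level hA hα ha
  obtain ⟨K, K_pos, cost_le⟩ :=
    exists_sampling_cost_le_costRate (β := β) hA hα hγ hp' one_le_C (b := 1 / (2 * b))
      (by positivity)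
  refine ⟨K, K_pos, fun ε hε hε2 => ?_⟩
  obtain ⟨L, one_le_L, bias_lt, rpow_L_le⟩ := exists_L ε hε (by linarith)
  obtain ⟨M, one_le_M, error_le, M_cost_le⟩ := exists_sampleSizes_error_le_and_cost_le
    (Finset.Icc 1 L) hp' (δ := 1 / (2 * b) * ε) (by positivity)
    (e := fun l : ℕ => A ^ (-(β * l))) (c := fun l : ℕ => A ^ (γ * l))
    (fun l => by positivity) (fun l => by positivity)
  have weight_eq (l : ℕ) : ((A ^ (-(β * l))) ^ p' * A ^ (γ * l)) ^ (1 / (p' + 1))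
      = A ^ ((γ - β * p') / (p' + 1) * l) := by
    rw [← Real.rpow_mul hA0.le, ← Real.rpow_add hA0, ← Real.rpow_mul hA0.le]
    ring_nf
  simp only [weight_eq] at M_cost_le
  refine ⟨L, M, one_le_L, one_le_M, ?_, M_cost_le.trans (cost_le ε L hε hε2 rpow_L_le)⟩
  have half_le : b * ∑ l ∈ Finset.Icc 1 L, (M l : ℝ) ^ (-(1 / p')) * A ^ (-(β * l)) ≤ ε / 2 := by
    refine (mul_le_mul_of_nonneg_left error_le hb.le).trans_eq ?_
    field_simp
  linarith

end LevelChoice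

section GeometricScale

variable {A C c x s : ℝ} {l : ℕ}

theorem mul_rpow_neg_le_of_mul_pow_le (hA : 0 < A) (hC : 0 ≤ C) (hc : 0 < c) (hs : 0 ≤ s)
    (h : c * A ^ l ≤ x) : C * x ^ (-s) ≤ C * c ^ (-s) * A ^ (-(s * l)) := by
  calc C * x ^ (-s) ≤ C * (c * A ^ l) ^ (-s) := mul_le_mul_of_nonneg_left
        (Real.rpow_le_rpow_of_nonpos (by positivity) h (neg_nonpos.2 hs)) hC
    _ = C * c ^ (-s) * A ^ (-(s * l)) := by
        rw [Real.mul_rpow hc.le (by positivity), ← Real.rpow_natCast, ← Real.rpow_mul hA.le]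
        ring_nf

theorem mul_rpow_le_of_le_mul_pow (hA : 0 < A) (hC : 0 ≤ C) (hc : 0 ≤ c) (hx : 0 ≤ x) (hs : 0 ≤ s)
    (h : x ≤ c * A ^ l) : C * x ^ s ≤ C * c ^ s * A ^ (s * l) := by
  calc C * x ^ s ≤ C * (c * A ^ l) ^ s := by gcongr
    _ = C * c ^ s * A ^ (s * l) := by
        rw [Real.mul_rpow hc (by positivity), ← Real.rpow_natCast, ← Real.rpow_mul hA.le]
        ring_nf

end GeometricScale

section Multilevel

variable {E Ω : Type*} [NormedAddCommGroup E] [NormedSpace ℝ E] [MeasurableSpace Ω] {μ : Measure Ω}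
  {k : ℕ}

theorem mlmcCost_le_mul_mlmcCost {cost cost' : ℕ → ℝ} {c : ℝ} {L : ℕ}
    (h : ∀ l ∈ Finset.Icc 1 L, cost l ≤ c * cost' l) (M : ℕ → ℕ) :
    mlmcCost cost L M ≤ c * mlmcCost cost' L M := by
  unfold mlmcCost
  rw [Finset.mul_sum]
  refine Finset.sum_le_sum fun l hl => ?_
  rw [mul_left_comm]
  exact mul_le_mul_of_nonneg_left (h l hl) (Nat.cast_nonneg _)

theorem sum_integral_levelDiff (hk : k ≠ 0) {X : ℕ → Ω → E} (hX0 : ∀ ω, X 0 ω = 0)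
    (hX : ∀ l, Integrable (fun ω => tensorPow k (X l ω)) μ) (L : ℕ) :
    ∑ l ∈ Finset.Icc 1 L, ∫ ω, levelDiff k X l ω ∂μ = injMoment k (X L) μ := by
  induction L with
  | zero => simp [injMoment, hX0, tensorPow_zero hk]
  | succ L ih =>
    rw [Finset.sum_Icc_succ_top (by lia), ih]
    unfold injMoment levelDiff
    rw [integral_sub (hX _) (hX _), Nat.add_sub_cancel, add_sub_cancel]

variable [IsProbabilityMeasure μ]

theorem eLpNorm_sub_mlmcEstimator_le_bias_add (hk : k ≠ 0) (m : SymInjTensor k E) {X : ℕ → Ω → E}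
    (hX0 : ∀ ω, X 0 ω = 0) (hX : ∀ l, Integrable (fun ω => tensorPow k (X l ω)) μ)
    {ξ : ℕ → ℕ → Ω → SymInjTensor k E} {r : ℝ≥0∞} (hr : 1 ≤ r) {L : ℕ}
    (hξ : ∀ l ∈ Finset.Icc 1 L, ∀ j, AEStronglyMeasurable (ξ l j) μ) (M : ℕ → ℕ) :
    eLpNorm (fun ω => m - mlmcEstimator ξ L M ω) r μ
      ≤ ENNReal.ofReal ‖m - injMoment k (X L) μ‖
        + ∑ l ∈ Finset.Icc 1 L, eLpNorm (fun ω => (M l : ℝ)⁻¹ • ∑ j ∈ Finset.range (M l), ξ l j ω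
          - ∫ x, levelDiff k X l x ∂μ) r μ := by
  have level_meas : ∀ l ∈ Finset.Icc 1 L, AEStronglyMeasurable (fun ω =>
      (M l : ℝ)⁻¹ • ∑ j ∈ Finset.range (M l), ξ l j ω - ∫ x, levelDiff k X l x ∂μ) μ :=
    fun l hl => ((Finset.aestronglyMeasurable_fun_sum _ fun j _ => hξ l hl j).const_smul
      (M l : ℝ)⁻¹).sub aestronglyMeasurable_const
  have error_eq : (fun ω => m - mlmcEstimator ξ L M ω)
      = (fun _ => m - injMoment k (X L) μ) - ∑ l ∈ Finset.Icc 1 L, fun ω =>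
        ((M l : ℝ)⁻¹ • ∑ j ∈ Finset.range (M l), ξ l j ω - ∫ x, levelDiff k X l x ∂μ) := by
    ext1 ω
    simp only [Pi.sub_apply, Finset.sum_apply, Finset.sum_sub_distrib]
    rw [sum_integral_levelDiff hk hX0 hX L, mlmcEstimator]
    abel
  rw [error_eq]
  refine (eLpNorm_sub_le aestronglyMeasurable_const
    (Finset.aestronglyMeasurable_sum _ level_meas) hr).trans ?_
  gcongr ?_ + ?_
  · rw [eLpNorm_const _ (one_pos.trans_le hr).ne' (IsProbabilityMeasure.ne_zero μ), measure_univ,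
      ENNReal.one_rpow, mul_one, ofReal_norm]
  · exact eLpNorm_sum_le level_meas hr

/-- The constant in the Monte Carlo error bound for `k`-th tensor powers in `L_q`, when `τ` is the
type constant of `E`. -/
noncomputable def momentConst (k : ℕ) (q τ : ℝ) : ℝ := 2 * kahaneConst q * (8 * τ * k ^ 2)

theorem momentConst_pos (hk : k ≠ 0) {q τ : ℝ} (hq : 0 < q) (hτ : 0 < τ) :
    0 < momentConst k q τ := by
  have := kahaneConst_pos hq
  unfold momentConst
  positivity

variable {p q τ : ℝ}

theorem HasRademacherTypeWith.eLpNorm_monteCarlo_tensorPow_sub_le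
    (hE : HasRademacherTypeWith p τ E) (hp : 1 ≤ p) (hp2 : p ≤ 2) (hq : p ≤ q) (hτ : 0 ≤ τ)
    (hk : k ≠ 0) {X Y : Ω → E} {S : ℝ≥0∞}
    (hX : MemLp X (k * ENNReal.ofReal q) μ) (hXS : eLpNorm X (k * ENNReal.ofReal q) μ ≤ S)
    (hY : MemLp Y (k * ENNReal.ofReal q) μ) (hYS : eLpNorm Y (k * ENNReal.ofReal q) μ ≤ S)
    {ξ : ℕ → Ω → SymInjTensor k E}
    (hξ : ∀ j, IdentDistrib (ξ j) (fun ω => tensorPow k (X ω) - tensorPow k (Y ω)) μ μ)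
    (hξ_indep : iIndepFun ξ μ) {n : ℕ} (hn : n ≠ 0) :
    eLpNorm (fun ω => (n : ℝ)⁻¹ • ∑ j ∈ Finset.range n, ξ j ω
        - ∫ x, tensorPow k (X x) - tensorPow k (Y x) ∂μ) (ENNReal.ofReal q) μ
      ≤ ENNReal.ofReal (momentConst k q τ * n ^ (1 / p - 1))
        * ((2 * S) ^ (k - 1) * eLpNorm (fun ω => X ω - Y ω) (k * ENNReal.ofReal q) μ) := by
  have one_le_q : 1 ≤ ENNReal.ofReal q := by simpa using hp.trans hq
  have k_le : (k : ℝ≥0∞) ≤ k * ENNReal.ofReal q := le_mul_of_one_le_right' one_le_q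
  refine (((hE.isRademacherDominated_tensorPow_sub hp hτ hk).comp
    fun ω => (X ω, Y ω)).eLpNorm_monteCarlo_sub_le hp hp2 hq (by positivity)
    (fun _ => powDist_nonneg _ _)
    (continuous_powDist.comp_aestronglyMeasurable (hX.1.prodMk hY.1))
    ((integrable_tensorPow (hX.mono_exponent k_le)).sub
      (integrable_tensorPow (hY.mono_exponent k_le))) hξ hξ_indep hn).trans ?_
  gcongr
  · exact le_rfl
  · exact eLpNorm_powDist_le hk one_le_q hX.1 hY.1 hXS hYS

theorem HasRademacherTypeWith.eLpNorm_sub_mlmcEstimator_le (hE : HasRademacherTypeWith p τ E)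
    (hp : 1 ≤ p) (hp2 : p ≤ 2) (hq : p ≤ q) (hτ : 0 ≤ τ) (hk : k ≠ 0) (m : SymInjTensor k E)
    {X : ℕ → Ω → E} (hX0 : ∀ ω, X 0 ω = 0) (hX : ∀ l, AEStronglyMeasurable (X l) μ) {S : ℝ}
    (hS : 0 ≤ S) (hXS : ∀ l, eLpNorm (X l) (k * ENNReal.ofReal q) μ ≤ ENNReal.ofReal S)
    {ξ : ℕ → ℕ → Ω → SymInjTensor k E} {L : ℕ}
    (hξ : ∀ l ∈ Finset.Icc 1 L, ∀ j, IdentDistrib (ξ l j) (levelDiff k X l) μ μ)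
    (hξ_indep : ∀ l ∈ Finset.Icc 1 L, iIndepFun (ξ l) μ) {M : ℕ → ℕ}
    (hM : ∀ l ∈ Finset.Icc 1 L, 1 ≤ M l) {d : ℕ → ℝ} (hd : ∀ l ∈ Finset.Icc 1 L, 0 ≤ d l)
    (hXd : ∀ l ∈ Finset.Icc 1 L,
      eLpNorm (fun ω => X l ω - X (l - 1) ω) (k * ENNReal.ofReal q) μ ≤ ENNReal.ofReal (d l)) :
    eLpNorm (fun ω => m - mlmcEstimator ξ L M ω) (ENNReal.ofReal q) μ
      ≤ ENNReal.ofReal (‖m - injMoment k (X L) μ‖ + momentConst k q τ * (2 * S) ^ (k - 1)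
        * ∑ l ∈ Finset.Icc 1 L, (M l : ℝ) ^ (1 / p - 1) * d l) := by
  have one_le_q : 1 ≤ ENNReal.ofReal q := by simpa using hp.trans hq
  have memLp l : MemLp (X l) (k * ENNReal.ofReal q) μ :=
    ⟨hX l, (hXS l).trans_lt ENNReal.ofReal_lt_top⟩
  have integrable l : Integrable (fun ω => tensorPow k (X l ω)) μ :=
    integrable_tensorPow ((memLp l).mono_exponent (le_mul_of_one_le_right' one_le_q))
  have const_nonneg : 0 ≤ momentConst k q τ := by
    have := kahaneConst_pos (one_pos.trans_le (hp.trans hq))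
    unfold momentConst
    positivity
  have level_le : ∀ l ∈ Finset.Icc 1 L,
      eLpNorm (fun ω => (M l : ℝ)⁻¹ • ∑ j ∈ Finset.range (M l), ξ l j ω
        - ∫ x, levelDiff k X l x ∂μ) (ENNReal.ofReal q) μ
      ≤ ENNReal.ofReal
        (momentConst k q τ * (2 * S) ^ (k - 1) * ((M l : ℝ) ^ (1 / p - 1) * d l)) := by
    intro l hl
    refine (hE.eLpNorm_monteCarlo_tensorPow_sub_le hp hp2 hq hτ hk (memLp l) (hXS l) (memLp (l - 1))
      (hXS (l - 1)) (hξ l hl) (hξ_indep l hl) (Nat.one_le_iff_ne_zero.1 (hM l hl))).trans ?_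
    calc _ ≤ ENNReal.ofReal (momentConst k q τ * M l ^ (1 / p - 1))
          * ((2 * ENNReal.ofReal S) ^ (k - 1) * ENNReal.ofReal (d l)) := by
          gcongr
          exact hXd l hl
      _ = _ := by
          rw [← ENNReal.ofReal_ofNat 2, ← ENNReal.ofReal_mul zero_le_two,
            ← ENNReal.ofReal_pow (by positivity), ← ENNReal.ofReal_mul (by positivity),
            ← ENNReal.ofReal_mul (by positivity)]
          ring_nf
  have level_nonneg : ∀ l ∈ Finset.Icc 1 L,
      0 ≤ momentConst k q τ * (2 * S) ^ (k - 1) * ((M l : ℝ) ^ (1 / p - 1) * d l) :=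
    fun l hl => by have := hd l hl; positivity
  have ξ_meas : ∀ l ∈ Finset.Icc 1 L, ∀ j, AEStronglyMeasurable (ξ l j) μ := fun l hl j =>
    (hξ l hl j).symm.aestronglyMeasurable_snd ((integrable l).sub (integrable (l - 1))).1
  refine (eLpNorm_sub_mlmcEstimator_le_bias_add hk m hX0 integrable one_le_q ξ_meas M).trans ?_
  rw [Finset.mul_sum, ENNReal.ofReal_add (norm_nonneg _) (Finset.sum_nonneg level_nonneg),
    ENNReal.ofReal_sum_of_nonneg level_nonneg]
  gcongr with l hl
  exact level_le l hl

theorem HasRademacherTypeWith.eLpNorm_sub_mlmcEstimator_le_of_rpow_neg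
    (hE : HasRademacherTypeWith p τ E) (hp : 1 ≤ p) (hp2 : p ≤ 2) {p' : ℝ}
    (hpp' : 1 / p + 1 / p' = 1) (hq : p ≤ q) (hτ : 0 ≤ τ) (hk : k ≠ 0)
    {α β A Cα Cβ c S : ℝ} (hα : 0 ≤ α) (hβ : 0 ≤ β) (hA : 0 < A) (hCα : 0 ≤ Cα) (hCβ : 0 ≤ Cβ)
    (hc : 0 < c) (hS : 0 ≤ S) (m : SymInjTensor k E) {X : ℕ → Ω → E} (hX0 : ∀ ω, X 0 ω = 0)
    (hX : ∀ l, 1 ≤ l → AEStronglyMeasurable (X l) μ)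
    (hXS : ∀ l, 1 ≤ l → eLpNorm (X l) (k * ENNReal.ofReal q) μ ≤ ENNReal.ofReal S)
    {N : ℕ → ℝ} (hN : ∀ l, 1 ≤ l → c * A ^ l ≤ N l)
    (hdiff : ∀ l, 1 ≤ l → eLpNorm (fun ω => X l ω - X (l - 1) ω) (k * ENNReal.ofReal q) μ
      ≤ ENNReal.ofReal (Cβ * N l ^ (-β)))
    {ξ : ℕ → ℕ → Ω → SymInjTensor k E}
    (hξ : ∀ l, 1 ≤ l → ∀ j, IdentDistrib (ξ l j) (levelDiff k X l) μ μ)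
    (hξ_indep : ∀ l, 1 ≤ l → iIndepFun (ξ l) μ) {L : ℕ} (hL : 1 ≤ L)
    (hbias : ‖m - injMoment k (X L) μ‖ ≤ Cα * N L ^ (-α)) {M : ℕ → ℕ}
    (hM : ∀ l ∈ Finset.Icc 1 L, 1 ≤ M l) :
    eLpNorm (fun ω => m - mlmcEstimator ξ L M ω) (ENNReal.ofReal q) μ
      ≤ ENNReal.ofReal (Cα * c ^ (-α) * A ^ (-(α * L))
        + momentConst k q τ * (2 * S) ^ (k - 1) * (Cβ * c ^ (-β))
          * ∑ l ∈ Finset.Icc 1 L, (M l : ℝ) ^ (-(1 / p')) * A ^ (-(β * l))) := by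
  have one_le {l} (hl : l ∈ Finset.Icc 1 L) : 1 ≤ l := (Finset.mem_Icc.1 hl).1
  have stable l : AEStronglyMeasurable (X l) μ
      ∧ eLpNorm (X l) (k * ENNReal.ofReal q) μ ≤ ENNReal.ofReal S := by
    rcases Nat.eq_zero_or_pos l with rfl | hl
    · rw [show X 0 = 0 from funext hX0]
      exact ⟨aestronglyMeasurable_zero, by simp⟩
    · exact ⟨hX l hl, hXS l hl⟩
  have diff_le : ∀ l ∈ Finset.Icc 1 L,
      eLpNorm (fun ω => X l ω - X (l - 1) ω) (k * ENNReal.ofReal q) μ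
        ≤ ENNReal.ofReal (Cβ * c ^ (-β) * A ^ (-(β * l))) := fun l hl =>
    (hdiff l (one_le hl)).trans (ENNReal.ofReal_le_ofReal
      (mul_rpow_neg_le_of_mul_pow_le hA hCβ hc hβ (hN l (one_le hl))))
  refine (hE.eLpNorm_sub_mlmcEstimator_le hp hp2 hq hτ hk m hX0 (fun l => (stable l).1) hS
    (fun l => (stable l).2) (fun l hl => hξ l (one_le hl)) (fun l hl => hξ_indep l (one_le hl)) hM
    (fun l _ => by positivity) diff_le).trans (ENNReal.ofReal_le_ofReal (add_le_add
      (hbias.trans (mul_rpow_neg_le_of_mul_pow_le hA hCα hc hα (hN L hL))) (le_of_eq ?_)))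
  simp only [mul_left_comm _ (Cβ * c ^ (-β)), ← Finset.mul_sum]
  rw [show 1 / p - 1 = -(1 / p') by linarith]
  ring

end Multilevel

theorem mainTheorem3_general
    (p p' q : ℝ) (hp : 1 < p) (hp2 : p ≤ 2) (hpp' : 1 / p + 1 / p' = 1) (hq : p ≤ q)
    (k : ℕ) (hk : 1 ≤ k)
    (α β γ A Cα Cβ Cγ Cstab c₁ c₂ τ : ℝ)
    (hα : 0 < α) (hβ : 0 < β) (hγ : 0 < γ) (hA : 1 < A)
    (hCα : 0 < Cα) (hCβ : 0 < Cβ) (hCγ : 0 < Cγ) (hCstab : 0 < Cstab)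
    (hc₁ : 0 < c₁) (hc₂ : 0 < c₂) (hτ : 0 < τ) :
    ∃ K : ℝ, 0 < K ∧
      ∀ (E : Type u) [NormedAddCommGroup E] [NormedSpace ℝ E], HasRademacherTypeWith p τ E →
      ∀ (Ω : Type v) [MeasurableSpace Ω] (μ : Measure Ω) [IsProbabilityMeasure μ]
        (m : SymInjTensor k E) (Xs : ℕ → Ω → E) (ξ : ℕ → ℕ → Ω → SymInjTensor k E)
        (cost N : ℕ → ℝ),
        (∀ ω, Xs 0 ω = 0) →
        (∀ l, 1 ≤ l → AEStronglyMeasurable (Xs l) μ) →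
        (∀ l, 1 ≤ l → c₁ * A ^ l ≤ N l ∧ N l ≤ c₂ * A ^ l) →
        (∀ l, 1 ≤ l → ‖m - injMoment k (Xs l) μ‖ ≤ Cα * N l ^ (-α)) →
        (∀ l, 1 ≤ l → eLpNorm (fun ω => Xs l ω - Xs (l - 1) ω) (ENNReal.ofReal (k * q)) μ
          ≤ ENNReal.ofReal (Cβ * N l ^ (-β))) →
        (∀ l, 1 ≤ l → cost l ≤ Cγ * N l ^ γ) →
        (∀ l, 1 ≤ l → eLpNorm (Xs l) (ENNReal.ofReal (k * q)) μ ≤ ENNReal.ofReal Cstab) →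
        (∀ l, 1 ≤ l → ∀ j, IdentDistrib (ξ l j) (levelDiff k Xs l) μ μ) →
        (∀ l, 1 ≤ l → iIndepFun (ξ l) μ) →
        ∀ ε : ℝ, 0 < ε → ε ≤ 1 / 2 →
          ∃ (L : ℕ) (M : ℕ → ℕ), 1 ≤ L ∧ (∀ l, 1 ≤ l → l ≤ L → 1 ≤ M l) ∧
            eLpNorm (fun ω => m - mlmcEstimator ξ L M ω) (ENNReal.ofReal q) μ
              < ENNReal.ofReal ε ∧
            mlmcCost cost L M ≤ K * costRate α β γ A p' ε := by
  have hA0 : 0 < A := one_pos.trans hA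
  have hk0 : k ≠ 0 := Nat.one_le_iff_ne_zero.1 hk
  have p'_pos : 0 < p' := by
    have : 1 / p < 1 := (div_lt_one (by linarith)).2 hp
    exact one_div_pos.1 (by linarith)
  have const_pos := momentConst_pos hk0 (q := q) (by linarith) hτ
  obtain ⟨K, K_pos, exists_LM⟩ := exists_levels_and_sampleSizes (β := β) (a := Cα * c₁ ^ (-α))
    (b := momentConst k q τ * (2 * Cstab) ^ (k - 1) * (Cβ * c₁ ^ (-β)))
    hA hα hγ p'_pos (by positivity) (by positivity)
  refine ⟨Cγ * c₂ ^ γ * K, by positivity, ?_⟩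
  intro E _ _ hE Ω _ μ _ m Xs ξ cost N hX0 hX hN hbias hdiff hcost hstab hξ hξ_indep ε hε hε2
  obtain ⟨L, M, one_le_L, one_le_M, error_lt, cost_le⟩ := exists_LM ε hε hε2
  rw [ENNReal.ofReal_mul k.cast_nonneg, ENNReal.ofReal_natCast] at hdiff hstab
  refine ⟨L, M, one_le_L, fun l hl hlL => one_le_M l (Finset.mem_Icc.2 ⟨hl, hlL⟩), ?_, ?_⟩
  · exact (hE.eLpNorm_sub_mlmcEstimator_le_of_rpow_neg hp.le hp2 hpp' hq hτ.le hk0 hα.le hβ.le hA0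
      hCα.le hCβ.le hc₁ hCstab.le m hX0 hX hstab (fun l hl => (hN l hl).1) hdiff hξ hξ_indep
      one_le_L (hbias L one_le_L) one_le_M).trans_lt ((ENNReal.ofReal_lt_ofReal_iff hε).2 error_lt)
  · have level_cost_le : ∀ l ∈ Finset.Icc 1 L, cost l ≤ Cγ * c₂ ^ γ * A ^ (γ * l) := fun l hl => by
      have one_le_l := (Finset.mem_Icc.1 hl).1
      have N_nonneg : 0 ≤ N l := (by positivity : 0 ≤ c₁ * A ^ l).trans (hN l one_le_l).1
      exact (hcost l one_le_l).trans
        (mul_rpow_le_of_le_mul_pow hA0 hCγ.le hc₂.le N_nonneg hγ.le (hN l one_le_l).2)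
    calc mlmcCost cost L M ≤ Cγ * c₂ ^ γ * mlmcCost (fun l => A ^ (γ * l)) L M :=
          mlmcCost_le_mul_mlmcCost level_cost_le M
      _ ≤ Cγ * c₂ ^ γ * (K * costRate α β γ A p' ε) := by gcongr
      _ = _ := (mul_assoc _ _ _).symm

/-- The constant `K` depends only on the displayed parameters; `τ` bounds the type `p` constant of
`E`, and `c₁, c₂` are the constants in `N_ℓ ≍ A ^ ℓ`. -/
theorem mainTheorem3
    (p p' q : ℝ) (hp : 1 < p) (hp2 : p ≤ 2) (hpp' : 1 / p + 1 / p' = 1) (hq : p ≤ q)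
    (k : ℕ) (hk : 1 ≤ k)
    (α β γ A Cα Cβ Cγ Cstab c₁ c₂ τ : ℝ)
    (hα : 0 < α) (hβ : 0 < β) (hγ : 0 < γ) (hA : 1 < A)
    (hCα : 0 < Cα) (hCβ : 0 < Cβ) (hCγ : 0 < Cγ) (hCstab : 0 < Cstab)
    (hc₁ : 0 < c₁) (hc₂ : 0 < c₂) (hτ : 0 < τ) :
    ∃ K : ℝ, 0 < K ∧
      ∀ (E : Type u) [NormedAddCommGroup E] [NormedSpace ℝ E] [CompleteSpace E],
        HasRademacherTypeWith p τ E →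
      ∀ (Ω : Type v) [MeasurableSpace Ω] (μ : Measure Ω) [IsProbabilityMeasure μ]
        (X : Ω → E) (Xs : ℕ → Ω → E) (ξ : ℕ → ℕ → Ω → SymInjTensor k E)
        (cost : ℕ → ℝ) (N : ℕ → ℕ),
        MemLp X (k : ℝ≥0∞) μ →
        (∀ ω, Xs 0 ω = 0) →
        (∀ l, 1 ≤ l → MemLp (Xs l) (ENNReal.ofReal (k * q)) μ) →
        -- the discretization parameters
        (∀ l, 1 ≤ l → 0 < N l) →
        (∀ l, 1 ≤ l → c₁ * A ^ l ≤ N l ∧ (N l : ℝ) ≤ c₂ * A ^ l) →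
        -- decay of the bias, decay of the level differences, cost per sample, stability
        (∀ l, 1 ≤ l → ‖injMoment k X μ - injMoment k (Xs l) μ‖ ≤ Cα * (N l : ℝ) ^ (-α)) →
        (∀ l, 1 ≤ l → eLpNorm (fun ω => Xs l ω - Xs (l - 1) ω) (ENNReal.ofReal (k * q)) μ
          ≤ ENNReal.ofReal (Cβ * (N l : ℝ) ^ (-β))) →
        (∀ l, 1 ≤ l → cost l ≤ Cγ * (N l : ℝ) ^ γ) →
        (∀ l, 1 ≤ l → max (eLpNorm X (k : ℝ≥0∞) μ) (eLpNorm (Xs l) (ENNReal.ofReal (k * q)) μ)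
          ≤ ENNReal.ofReal Cstab) →
        -- on each level, independent copies of the level difference
        (∀ l, 1 ≤ l → ∀ j, MemLp (ξ l j) (ENNReal.ofReal q) μ) →
        (∀ l, 1 ≤ l → ∀ j, IdentDistrib (ξ l j) (levelDiff k Xs l) μ μ) →
        (∀ l, 1 ≤ l → iIndepFun (ξ l) μ) →
        ∀ ε : ℝ, 0 < ε → ε ≤ 1 / 2 →
          ∃ (L : ℕ) (M : ℕ → ℕ), 1 ≤ L ∧ (∀ l, 1 ≤ l → l ≤ L → 1 ≤ M l) ∧
            eLpNorm (fun ω => injMoment k X μ - mlmcEstimator ξ L M ω) (ENNReal.ofReal q) μ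
              < ENNReal.ofReal ε ∧
            mlmcCost cost L M ≤ K * costRate α β γ A p' ε := by
  obtain ⟨K, K_pos, hK⟩ := mainTheorem3_general.{u, v} p p' q hp hp2 hpp' hq k hk α β γ A Cα Cβ Cγ
    Cstab c₁ c₂ τ hα hβ hγ hA hCα hCβ hCγ hCstab hc₁ hc₂ hτ
  exact ⟨K, K_pos, fun E _ _ _ hE Ω _ μ _ X Xs ξ cost N _ hX0 hXs _ hN hbias hdiff hcost hstab _ =>
    hK E hE Ω μ (injMoment k X μ) Xs ξ cost (fun l => N l) hX0 (fun l hl => (hXs l hl).1) hN hbias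
      hdiff hcost fun l hl => (le_max_right _ _).trans (hstab l hl)⟩
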